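/- Let $k$ be a field, let $A$ be an associative unital $k$-algebra and let $B\subseteq A$ be a subalgebra. Modules are left modules unless stated otherwise. For a $k$-algebra $R$ put $R^e=R\otimes_k R^{op}$, so that $R^e$-modules are the $R$-bimodules on which $k$ acts centrally; $R$ is itself an $R^e$-module, and $B^e$ is a subalgebra of $A^e$. For an extension of rings $S\subseteq R$, an $R$-module $P$ is called $(R,S)$-projective if every $R$-module homomorphism onto $P$ that splits as a homomorphism of $S$-modules splits as a homomorphism of $R$-modules. An $R$-module $M$ has finite $(R,S)$-relative projective dimension if, for some $n\geq 0$, there is an exact sequence of $R$-modules $$0\to P_n\to\cdots\to P_1\to P_0\to M\to 0$$ in which every $P_i$ is $(R,S)$-projective and the kernel of every map is a direct summand, as an $S$-module, of the module on which the map is defined. The extension $B\subseteq A$ is called strongly proj-bounded if 1. $A/B$ has finite projective dimension as a $B^e$-module; 2. $A/B$ is projective as a left or as a right $B$-module; 3. there is $p\geq 1$ such that the tensor power $(A/B)^{\otimes_B n}$ is projective as a $B^e$-module for every $n\geq p$; 4. the $A^e$-module $A$ has finite $(A^e,B^e)$-relative projective dimension. The left global dimension of a ring $R$ is the supremum of the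 projective dimensions of all left $R$-modules, and $\operatorname{Findim}(R)$ is the supremum of the projective dimensions of all left $R$-modules (not necessarily finitely generated) of finite projective dimension. **Theorem.** Let $B\subseteq A$ be a strongly proj-bounded extension of $k$-algebras such that $A/B$ is projective as a right $B$-module. Then 1. $B$ has finite left global dimension if and only if $A$ has finite left global dimension; 2. $\operatorname{Findim}(B)$ is finite if and only if $\operatorname{Findim}(A)$ is finite. -/

import Mathlib

open CategoryTheory MulOpposite
open scoped TensorProduct ModuleCat

universe w u

namespace ProjBounded

noncomputable section

/-! ### Left global dimension and big left finitistic dimension -/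

section AbsoluteDimensions

variable (R : Type u) [Ring R]

/-- The left global dimension of `R`: the supremum of the projective dimensions of all left
`R`-modules (the zero module has projective dimension `⊥`). -/
def leftGlobalDim : WithBot ℕ∞ :=
  ⨆ M : ModuleCat.{u} R, projectiveDimension M

/-- The big left finitistic dimension `Findim R`: the supremum of the projective dimensions of
those left `R`-modules, finitely generated or not, whose projective dimension is finite. -/
def leftFindim : WithBot ℕ∞ :=
  ⨆ M : {M : ModuleCat.{u} R // projectiveDimension M ≠ ⊤}, projectiveDimension M.1

end AbsoluteDimensions

/-! ### Relative projective dimension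

For an extension `S ⊆ R` of rings, given by its inclusion `f : S →+* R`. -/

section RelativeDimension

variable {S R : Type u} [Ring S] [Ring R] (f : S →+* R)

/-- An `R`-module `P` is `(R, S)`-projective if every `R`-module homomorphism onto `P` which
splits as a homomorphism of `S`-modules splits as a homomorphism of `R`-modules. -/
def IsRelProjective (P : ModuleCat.{u} R) : Prop :=
  ∀ (N : ModuleCat.{u} R) (g : N ⟶ P),
    IsSplitEpi ((ModuleCat.restrictScalars f).map g) → IsSplitEpi g

/-- The kernel of the `R`-module homomorphism `g : M ⟶ N` is a direct summand of `M` as an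
`S`-module. -/
def KernelSplits {M N : ModuleCat.{u} R} (g : M ⟶ N) : Prop :=
  IsComplemented (LinearMap.ker ((ModuleCat.restrictScalars f).map g).hom)

/-- An `(R, S)`-exact sequence `0 → P n → ⋯ → P 1 → P 0 → M → 0` of `R`-modules in which every
`P i` is `(R, S)`-projective. It is stored as an infinite sequence with `P i = 0` for `i > n`. -/
structure RelProjResolution (M : ModuleCat.{u} R) (n : ℕ) where
  P : ℕ → ModuleCat.{u} R
  d : ∀ i, P (i + 1) ⟶ P i
  aug : P 0 ⟶ M
  relProjective : ∀ i, IsRelProjective f (P i)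
  eq_zero : ∀ i, n < i → Subsingleton (P i)
  aug_surjective : Function.Surjective aug.hom
  exact_zero : LinearMap.range (d 0).hom = LinearMap.ker aug.hom
  exact_succ : ∀ i, LinearMap.range (d (i + 1)).hom = LinearMap.ker (d i).hom
  aug_splits : KernelSplits f aug
  d_splits : ∀ i, KernelSplits f (d i)

/-- `pd_{(R, S)} M` is finite. -/
def HasFiniteRelProjDim (M : ModuleCat.{u} R) : Prop :=
  ∃ n : ℕ, Nonempty (RelProjResolution f M n)

end RelativeDimension

/-! ### Bimodules and their tensor product -/

section Bimodules

variable (k : Type w) [Field k]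

/-- The enveloping algebra `R ⊗ Rᵒᵖ`. Its left modules are the `R`-bimodules on which `k` acts
centrally; the left action of `r` is that of `r ⊗ 1`, its right action that of `1 ⊗ r`. -/
abbrev Env (R : Type u) [Ring R] [Algebra k R] : Type u := R ⊗[k] Rᵐᵒᵖ

variable {R : Type u} [Ring R] [Algebra k R]

/-- The left action of `R` on a bimodule. -/
def leftAct (M : ModuleCat.{u} (Env k R)) : R →ₐ[k] Module.End k M :=
  (Algebra.lsmul k k M : Env k R →ₐ[k] Module.End k M).comp
    Algebra.TensorProduct.includeLeft

/-- The right action of `R` on a bimodule. -/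
def rightAct (M : ModuleCat.{u} (Env k R)) : Rᵐᵒᵖ →ₐ[k] Module.End k M :=
  (Algebra.lsmul k k M : Env k R →ₐ[k] Module.End k M).comp
    Algebra.TensorProduct.includeRight

/-- A bimodule regarded as a left `R`-module. -/
def toLeft (M : ModuleCat.{u} (Env k R)) : ModuleCat.{u} R :=
  (ModuleCat.restrictScalars
    (Algebra.TensorProduct.includeLeft : R →ₐ[k] Env k R).toRingHom).obj M

/-- A bimodule regarded as a right `R`-module, that is, as a left `Rᵐᵒᵖ`-module. -/
def toRight (M : ModuleCat.{u} (Env k R)) : ModuleCat.{u} Rᵐᵒᵖ :=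
  (ModuleCat.restrictScalars
    (Algebra.TensorProduct.includeRight : Rᵐᵒᵖ →ₐ[k] Env k R).toRingHom).obj M

variable (R) in
/-- `R` as a bimodule over itself: `(a ⊗ b) • x = a * x * b`. -/
def regular : ModuleCat.{u} (Env k R) :=
  letI : Module (Env k R) R := instModuleTensorProductMop k R
  ModuleCat.of (Env k R) R

variable (M N : ModuleCat.{u} (Env k R))

/-- The underlying space of the tensor product of two bimodules over the ground field, with the
left action of `R` on the first factor and the right action of `R` on the second. -/
def OuterTensor : Type u := M ⊗[k] N

instance : AddCommGroup (OuterTensor k M N) := inferInstanceAs (AddCommGroup (M ⊗[k] N))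

/-- `(a ⊗ b) (m ⊗ n) = (a m) ⊗ (n b)`. -/
def outerAct : Env k R →ₐ[k] Module.End k (M ⊗[k] N) :=
  Algebra.TensorProduct.lift
    ((Module.End.rTensorAlgHom k M N).comp (leftAct k M))
    ((Module.End.lTensorAlgHom k N M).comp (rightAct k N))
    (fun a b ↦ by
      change _ * _ = _ * _
      refine TensorProduct.ext' fun m n ↦ ?_
      rfl)

instance : Module (Env k R) (OuterTensor k M N) :=
  letI : Module (Module.End k (M ⊗[k] N)) (OuterTensor k M N) :=
    inferInstanceAs (Module (Module.End k (M ⊗[k] N)) (M ⊗[k] N))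
  Module.compHom (OuterTensor k M N) (outerAct k M N).toRingHom

/-- The subbimodule spanned by the elements `(m r) ⊗ n - m ⊗ (r n)`. -/
def balancingRel : Submodule (Env k R) (OuterTensor k M N) :=
  Submodule.span (Env k R)
    {x | ∃ (m : M) (r : R) (n : N),
      x = (((rightAct k M (op r) m) ⊗ₜ[k] n - m ⊗ₜ[k] (leftAct k N r n) : M ⊗[k] N))}

/-- The tensor product `M ⊗_R N` of two bimodules, as a bimodule. -/
def bimodTensor : ModuleCat.{u} (Env k R) :=
  ModuleCat.of (Env k R) (OuterTensor k M N ⧸ balancingRel k M N)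

/-- The tensor powers `M ⊗_R ⋯ ⊗_R M` (`n` factors) of a bimodule; the power for `n = 0` is `R`. -/
def bimodPow (M : ModuleCat.{u} (Env k R)) : ℕ → ModuleCat.{u} (Env k R)
  | 0 => regular k R
  | n + 1 => bimodTensor k M (bimodPow M n)

end Bimodules

/-! ### Strongly proj-bounded extensions -/

section Extensions

variable {k : Type w} {A : Type u} [Field k] [Ring A] [Algebra k A] (B : Subalgebra k A)

/-- The inclusion of enveloping algebras `B ⊗ Bᵒᵖ → A ⊗ Aᵒᵖ`. -/
def envInclusion : Env k B →ₐ[k] Env k A :=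
  Algebra.TensorProduct.map B.val (AlgHom.op B.val)

theorem val_mulLeftRight (e : Env k B) (x : B) :
    (AlgHom.mulLeftRight k B e x : A) = AlgHom.mulLeftRight k A (envInclusion B e) x := by
  induction e using TensorProduct.induction_on with
  | zero => simp
  | tmul a b => simp [envInclusion]
  | add e e' h h' => simp only [map_add, LinearMap.add_apply, Subalgebra.coe_add, h, h']

/-- The `B`-bimodule `A`. -/
def ambient : ModuleCat.{u} (Env k B) :=
  (ModuleCat.restrictScalars (envInclusion B).toRingHom).obj (regular k A)

/-- The inclusion `B → A` as a homomorphism of `B`-bimodules. -/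
def bimodInclusion : regular k B ⟶ ambient B :=
  ModuleCat.ofHom (X := (regular k B : Type u)) (Y := (ambient B : Type u))
    { toFun := fun b ↦ (B.val b : A)
      map_add' := fun x y ↦ map_add B.val x y
      map_smul' := fun e x ↦ val_mulLeftRight B e x }

/-- The `B`-bimodule `A/B`. -/
def quot : ModuleCat.{u} (Env k B) :=
  ModuleCat.of (Env k B) (ambient B ⧸ LinearMap.range (bimodInclusion B).hom)

/-- The extension `B ⊆ A` is proj-bounded. -/
structure IsProjBounded : Prop where
  /-- `A/B` has finite projective dimension as a `B`-bimodule. -/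
  finite_projDim : projectiveDimension (quot B) ≠ ⊤
  /-- `A/B` is projective as a left or as a right `B`-module. -/
  one_sided : Projective (toLeft k (quot B)) ∨ Projective (toRight k (quot B))
  /-- All sufficiently high tensor powers of `A/B` over `B` are projective `B`-bimodules. -/
  tensor_powers : ∃ p : ℕ, 1 ≤ p ∧ ∀ n : ℕ, p ≤ n → Projective (bimodPow k (quot B) n)

/-- The extension `B ⊆ A` is strongly proj-bounded: it is proj-bounded, and the `A`-bimodule `A`
has finite projective dimension relative to the extension of enveloping algebras. -/
structure IsStronglyProjBounded : Prop extends IsProjBounded B where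
  finite_relProjDim : HasFiniteRelProjDim (envInclusion B).toRingHom (regular k A)

end Extensions

end

end ProjBounded

/-! Over a field, tensor products that are exact on one side let projective dimensions be compared
across bimodules. If `X` is an `R`-`S`-bimodule, projective on the right, then `X ⊗_S -` is exact
and `pd_R (X ⊗_S Y) ≤ pd_R X + pd_S Y` (`PdLE.balTensor`). Since `A/B` is right projective, so is
`A` over `B`; since `A/B` has finite dimension as a bimodule, `A` has finite dimension `d` as a left
`B`-module.

Bounding dimensions over `A` by those over `B`: the map `A ⊗_B N ⊗_B A → N` is a relatively split
surjection from a relatively projective bimodule. Iterating it from `N = A` gives a canonical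
relative resolution whose syzygies are tame: right `A`-projective, of finite left `B`-dimension. The
assumed finite resolution has terms about which nothing of the sort is known, so it serves only
through a Schanuel comparison (`StableRetract.syzygy`), which shows that a canonical syzygy is
eventually relatively projective. Tensoring the canonical sequence with an `A`-module `M` leaves it
exact and bounds `pd_A M` by a constant plus the `B`-dimensions of the modules `(N ⊗_B A) ⊗_A M`
(`exists_pdLE_of_hasFiniteRelProjDim`).

Bounding dimensions over `B` by those over `A`: tensor `0 → B → A → A/B → 0` with `(A/B)^{⊗n} ⊗_B
Y`. The middle term is induced from `B` to `A`, hence controlled over `A`; the right term is the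
next tensor power. For `n = p` the power is a projective bimodule, so `(A/B)^{⊗p} ⊗_B Y` is
projective, and the bound descends to `n = 0` without growing (`pdLE_of_bimodPow_projective`).

For `Findim` the same inequalities apply once the modules being bounded are known to have finite
dimension, which is what tameness and `exists_pdLE_bimodPow` supply. -/

namespace ProjBounded

noncomputable section

/-! ### Balanced tensor products over a noncommutative algebra -/

section BalancedTensor

variable (k : Type w) [Field k] (S : Type u) [Ring S]
variable (X : Type u) [AddCommGroup X] [Module k X] [Module Sᵐᵒᵖ X]
variable (Y : Type u) [AddCommGroup Y] [Module k Y] [Module S Y]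

/-- The relations `(x s) ⊗ y = x ⊗ (s y)`. -/
def balRel : Submodule k (X ⊗[k] Y) :=
  Submodule.span k {t | ∃ (x : X) (s : S) (y : Y), t = (op s • x) ⊗ₜ[k] y - x ⊗ₜ[k] (s • y)}

/-- The tensor product `X ⊗_S Y` of a right and a left module over a `k`-algebra `S`. -/
def BalTensor : Type u := (X ⊗[k] Y) ⧸ balRel k S X Y

instance : AddCommGroup (BalTensor k S X Y) := inferInstanceAs (AddCommGroup (_ ⧸ balRel k S X Y))

namespace BalTensor

/-- The quotient map `X ⊗_k Y → X ⊗_S Y`. -/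
def proj : X ⊗[k] Y →+ BalTensor k S X Y := (balRel k S X Y).mkQ.toAddMonoidHom

theorem proj_surjective : Function.Surjective (proj k S X Y) := (balRel k S X Y).mkQ_surjective

variable {X Y}

/-- The pure tensors of `X ⊗_S Y`. -/
def mk (x : X) (y : Y) : BalTensor k S X Y := proj k S X Y (x ⊗ₜ y)

theorem proj_tmul (x : X) (y : Y) : proj k S X Y (x ⊗ₜ y) = mk k S x y := rfl

theorem mk_add (x : X) (y y' : Y) : mk k S x (y + y') = mk k S x y + mk k S x y' := by
  simp [mk, TensorProduct.tmul_add]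

theorem add_mk (x x' : X) (y : Y) : mk k S (x + x') y = mk k S x y + mk k S x' y := by
  simp [mk, TensorProduct.add_tmul]

theorem mk_zero (x : X) : mk k S x (0 : Y) = 0 := by simp [mk]

theorem zero_mk (y : Y) : mk k S (0 : X) y = 0 := by simp [mk]

theorem mk_balanced (x : X) (s : S) (y : Y) : mk k S (op s • x) y = mk k S x (s • y) := by
  refine (Submodule.Quotient.eq (balRel k S X Y)).2 (Submodule.subset_span ⟨x, s, y, rfl⟩)

theorem smul_mk_eq (c : k) (x : X) (y : Y) : mk k S (c • x) y = mk k S x (c • y) := by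
  simp [mk, TensorProduct.smul_tmul]

variable {k S}

@[elab_as_elim]
theorem induction_on {p : BalTensor k S X Y → Prop} (z : BalTensor k S X Y)
    (zero : p 0) (mk : ∀ x y, p (mk k S x y)) (add : ∀ z z', p z → p z' → p (z + z')) : p z := by
  obtain ⟨t, rfl⟩ := proj_surjective k S X Y z
  induction t using TensorProduct.induction_on with
  | zero => simpa using zero
  | tmul x y => exact mk x y
  | add t t' h h' => simpa using add _ _ h h'

variable {Z : Type*} [AddCommGroup Z]

theorem addHom_ext {f g : BalTensor k S X Y →+ Z} (h : ∀ x y, f (mk k S x y) = g (mk k S x y)) :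
    f = g := by
  ext z
  induction z using induction_on with
  | zero => simp
  | mk x y => exact h x y
  | add z z' h h' => simp [h, h']

/-- The additive map out of `X ⊗_S Y` given by a balanced map out of `X ⊗_k Y`. -/
def lift [Module k Z] (f : X ⊗[k] Y →ₗ[k] Z)
    (hf : ∀ x (s : S) y, f ((op s • x) ⊗ₜ y) = f (x ⊗ₜ (s • y))) : BalTensor k S X Y →+ Z :=
  ((balRel k S X Y).liftQ f (Submodule.span_le.2 (by
    rintro _ ⟨x, s, y, rfl⟩
    simp [hf]))).toAddMonoidHom

theorem lift_proj [Module k Z] (f : X ⊗[k] Y →ₗ[k] Z) (hf) (t : X ⊗[k] Y) :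
    lift (S := S) f hf (proj k S X Y t) = f t :=
  rfl

@[simp]
theorem lift_mk [Module k Z] (f : X ⊗[k] Y →ₗ[k] Z) (hf) (x : X) (y : Y) :
    lift (S := S) f hf (mk k S x y) = f (x ⊗ₜ y) :=
  lift_proj f hf _

/-! #### Left and right actions -/

section Actions

variable {C : Type*} [Ring C] [Module C X] [SMulCommClass C k X] [SMulCommClass C Sᵐᵒᵖ X]

/-- The action of a scalar on the left factor. -/
def leftMul (c : C) : BalTensor k S X Y →+ BalTensor k S X Y :=
  ((balRel k S X Y).mapQ (balRel k S X Y)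
    ((Module.toModuleEnd k X c).rTensor Y : X ⊗[k] Y →ₗ[k] X ⊗[k] Y) (Submodule.span_le.2 (by
      rintro _ ⟨x, s, y, rfl⟩
      refine Submodule.subset_span ⟨c • x, s, y, ?_⟩
      simp [smul_comm c (op s) x]))).toAddMonoidHom

theorem leftMul_mk (c : C) (x : X) (y : Y) : leftMul c (mk k S x y) = mk k S (c • x) y := rfl

instance : Module C (BalTensor k S X Y) where
  smul c := leftMul c
  one_smul z := DFunLike.congr_fun
    (addHom_ext (f := leftMul (1 : C)) (g := .id _) (by simp [leftMul_mk])) z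
  mul_smul c d z := DFunLike.congr_fun
    (addHom_ext (f := leftMul (c * d)) (g := (leftMul c).comp (leftMul d))
      (by simp [leftMul_mk, mul_smul])) z
  smul_zero c := map_zero (leftMul c)
  smul_add c := map_add (leftMul c)
  add_smul c d z := DFunLike.congr_fun
    (addHom_ext (f := leftMul (c + d)) (g := leftMul c + leftMul d)
      (by simp [leftMul_mk, add_smul, add_mk])) z
  zero_smul z := DFunLike.congr_fun
    (addHom_ext (f := leftMul (0 : C)) (g := 0) (by simp [leftMul_mk, zero_mk])) z

theorem smul_mk (c : C) (x : X) (y : Y) : c • mk k S x y = mk k S (c • x) y := rfl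

instance {C' : Type*} [Ring C'] [Module C' X] [SMulCommClass C' k X] [SMulCommClass C' Sᵐᵒᵖ X]
    [SMulCommClass C C' X] : SMulCommClass C C' (BalTensor k S X Y) where
  smul_comm c d z := DFunLike.congr_fun
    (addHom_ext (f := (leftMul c).comp (leftMul d)) (g := (leftMul d).comp (leftMul c))
      (by simp [leftMul_mk, smul_comm c d])) z

variable {D : Type*} [Ring D] [Module Dᵐᵒᵖ Y] [SMulCommClass Dᵐᵒᵖ k Y] [SMulCommClass Dᵐᵒᵖ S Y]

/-- The action of a scalar on the right factor. -/
def rightMul (d : Dᵐᵒᵖ) : BalTensor k S X Y →+ BalTensor k S X Y :=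
  ((balRel k S X Y).mapQ (balRel k S X Y)
    ((Module.toModuleEnd k Y d).lTensor X : X ⊗[k] Y →ₗ[k] X ⊗[k] Y) (Submodule.span_le.2 (by
      rintro _ ⟨x, s, y, rfl⟩
      refine Submodule.subset_span ⟨x, s, d • y, ?_⟩
      simp [smul_comm d s y]))).toAddMonoidHom

theorem rightMul_mk (d : Dᵐᵒᵖ) (x : X) (y : Y) : rightMul d (mk k S x y) = mk k S x (d • y) := rfl

instance : Module Dᵐᵒᵖ (BalTensor k S X Y) where
  smul c := rightMul c
  one_smul z := DFunLike.congr_fun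
    (addHom_ext (f := rightMul (1 : Dᵐᵒᵖ)) (g := .id _) (by simp [rightMul_mk])) z
  mul_smul c d z := DFunLike.congr_fun
    (addHom_ext (f := rightMul (c * d)) (g := (rightMul c).comp (rightMul d))
      (by simp [rightMul_mk, mul_smul])) z
  smul_zero c := map_zero (rightMul c)
  smul_add c := map_add (rightMul c)
  add_smul c d z := DFunLike.congr_fun
    (addHom_ext (f := rightMul (c + d)) (g := rightMul c + rightMul d)
      (by simp [rightMul_mk, add_smul, mk_add])) z
  zero_smul z := DFunLike.congr_fun
    (addHom_ext (f := rightMul (0 : Dᵐᵒᵖ)) (g := 0) (by simp [rightMul_mk, mk_zero])) z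

theorem op_smul_mk (d : Dᵐᵒᵖ) (x : X) (y : Y) : d • mk k S x y = mk k S x (d • y) := rfl

instance : SMulCommClass C Dᵐᵒᵖ (BalTensor k S X Y) where
  smul_comm c d z := DFunLike.congr_fun
    (addHom_ext (f := (leftMul c).comp (rightMul d)) (g := (rightMul d).comp (leftMul c))
      (by simp [rightMul_mk, leftMul_mk])) z

instance : SMulCommClass Dᵐᵒᵖ C (BalTensor k S X Y) := .symm _ _ _

end Actions

section Scalars

instance {C C' : Type*} [Ring C] [Ring C'] [SMul C C'] [Module C X] [Module C' X]
    [IsScalarTower C C' X] [SMulCommClass C k X] [SMulCommClass C Sᵐᵒᵖ X] [SMulCommClass C' k X]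
    [SMulCommClass C' Sᵐᵒᵖ X] : IsScalarTower C C' (BalTensor k S X Y) where
  smul_assoc a c z := DFunLike.congr_fun
    (addHom_ext (f := leftMul (a • c)) (g := (leftMul a).comp (leftMul c))
      (by simp [leftMul_mk])) z

variable [SMulCommClass k Sᵐᵒᵖ X]

instance {D : Type*} [Ring D] [Algebra k D] [Module Dᵐᵒᵖ Y] [IsScalarTower k Dᵐᵒᵖ Y]
    [SMulCommClass Dᵐᵒᵖ S Y] : IsScalarTower k Dᵐᵒᵖ (BalTensor k S X Y) where
  smul_assoc a d z := DFunLike.congr_fun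
    (addHom_ext (f := rightMul (a • d)) (g := (leftMul a).comp (rightMul d))
      (by simp [rightMul_mk, leftMul_mk, smul_mk_eq])) z

end Scalars

end BalTensor

end BalancedTensor

end

end ProjBounded

namespace ProjBounded

noncomputable section

/-! ### Free covers -/

section FreeCover

variable (k : Type w) [Field k] (R : Type u) [Ring R] [Algebra k R]
variable (X : Type u) [AddCommGroup X] [Module k X] [Module R X] [IsScalarTower k R X]

/-- The action map `R ⊗_k X → X`. -/
def freeCover : R ⊗[k] X →ₗ[R] X where
  __ := TensorProduct.lift ((Algebra.lsmul k k X).toLinearMap : R →ₗ[k] X →ₗ[k] X)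
  map_smul' := fun r w ↦ by
    induction w using TensorProduct.induction_on with
    | zero => simp
    | tmul t x => simp [TensorProduct.smul_tmul']
    | add w w' h h' => simp_all

@[simp]
theorem freeCover_tmul (r : R) (x : X) : freeCover k R X (r ⊗ₜ x) = r • x := by
  simp [freeCover]

theorem freeCover_surjective : Function.Surjective (freeCover k R X) :=
  fun x ↦ ⟨1 ⊗ₜ x, by simp⟩

/-- Because `k` is a field, `R ⊗_k X` is free over `R`; a projective module is a retract of this
particular free module. All the splittings below are built from this one. -/
theorem freeCover_splits [Module.Projective R X] :
    ∃ s : X →ₗ[R] R ⊗[k] X, ∀ x, freeCover k R X (s x) = x :=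
  let ⟨s, hs⟩ := Module.projective_lifting_property (freeCover k R X) LinearMap.id
    (freeCover_surjective k R X)
  ⟨s, LinearMap.congr_fun hs⟩

end FreeCover

namespace BalTensor

variable {k : Type w} [Field k] {S : Type u} [Ring S]
variable {X : Type u} [AddCommGroup X] [Module k X] [Module Sᵐᵒᵖ X]
variable {Y : Type u} [AddCommGroup Y] [Module k Y] [Module S Y]

/-! #### Functoriality -/

section Linear

variable {C : Type*} [Ring C] [Module C X] [SMulCommClass C k X] [SMulCommClass C Sᵐᵒᵖ X]

/-- An additive map out of `X ⊗_S Y` which is compatible with the left actions. -/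
def toLinear {Z : Type*} [AddCommGroup Z] [Module C Z] (f : BalTensor k S X Y →+ Z)
    (hf : ∀ (c : C) x y, f (mk k S (c • x) y) = c • f (mk k S x y)) :
    BalTensor k S X Y →ₗ[C] Z where
  __ := f
  map_smul' c z := DFunLike.congr_fun
    (addHom_ext (f := f.comp (leftMul c)) (g := (DistribSMul.toAddMonoidHom Z c).comp f)
      (by simp [leftMul_mk, hf])) z

@[simp]
theorem toLinear_apply {Z : Type*} [AddCommGroup Z] [Module C Z] (f : BalTensor k S X Y →+ Z)
    (hf) (z : BalTensor k S X Y) : toLinear (C := C) f hf z = f z := rfl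

theorem linearMap_ext {Z : Type*} [AddCommGroup Z] [Module C Z]
    {f g : BalTensor k S X Y →ₗ[C] Z} (h : ∀ x y, f (mk k S x y) = g (mk k S x y)) : f = g :=
  LinearMap.toAddMonoidHom_injective (addHom_ext h)

variable (X C) in
/-- The map `X ⊗_S Y → X ⊗_S Y'` induced by a map of left modules. -/
def mapRight [Algebra k S] [IsScalarTower k S Y] {Y' : Type u} [AddCommGroup Y'] [Module k Y'] [Module S Y']
    [IsScalarTower k S Y'] (g : Y →ₗ[S] Y') : BalTensor k S X Y →ₗ[C] BalTensor k S X Y' :=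
  toLinear (((balRel k S X Y).mapQ (balRel k S X Y') ((g.restrictScalars k).lTensor X)
    (Submodule.span_le.2 (by
      rintro _ ⟨x, s, y, rfl⟩
      exact Submodule.subset_span ⟨x, s, g y, by simp⟩))).toAddMonoidHom) fun _ _ _ ↦ rfl

@[simp]
theorem mapRight_mk [Algebra k S] [IsScalarTower k S Y] {Y' : Type u} [AddCommGroup Y'] [Module k Y']
    [Module S Y'] [IsScalarTower k S Y'] (g : Y →ₗ[S] Y') (x : X) (y : Y) :
    mapRight X C g (mk k S x y) = mk k S x (g y) := rfl

theorem mapRight_proj [Algebra k S] [IsScalarTower k S Y] {Y' : Type u} [AddCommGroup Y'] [Module k Y']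
    [Module S Y'] [IsScalarTower k S Y'] (g : Y →ₗ[S] Y') (t : X ⊗[k] Y) :
    mapRight X C g (proj k S X Y t) = proj k S X Y' ((g.restrictScalars k).lTensor X t) := rfl

theorem mapRight_surjective [Algebra k S] [IsScalarTower k S Y] {Y' : Type u} [AddCommGroup Y'] [Module k Y']
    [Module S Y'] [IsScalarTower k S Y'] (g : Y →ₗ[S] Y') (hg : Function.Surjective g) :
    Function.Surjective (mapRight (k := k) X C g) := by
  intro z
  induction z using induction_on with
  | zero => exact ⟨0, map_zero _⟩
  | mk x y =>
    obtain ⟨y, rfl⟩ := hg y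
    exact ⟨mk k S x y, rfl⟩
  | add z z' h h' =>
    obtain ⟨a, rfl⟩ := h
    obtain ⟨b, rfl⟩ := h'
    exact ⟨a + b, map_add _ _ _⟩

variable {X' : Type u} [AddCommGroup X'] [Module k X'] [Module Sᵐᵒᵖ X'] [Module C X']
  [SMulCommClass C k X'] [SMulCommClass C Sᵐᵒᵖ X']

variable (Y) in
/-- The map `X ⊗_S Y → X' ⊗_S Y` induced by a map of bimodules. -/
def mapLeft [Algebra k C] [IsScalarTower k C X] [IsScalarTower k C X'] (f : X →ₗ[C] X')
    (hf : ∀ (s : S) x, f (op s • x) = op s • f x) : BalTensor k S X Y →ₗ[C] BalTensor k S X' Y :=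
  toLinear (((balRel k S X Y).mapQ (balRel k S X' Y) ((f.restrictScalars k).rTensor Y)
    (Submodule.span_le.2 (by
      rintro _ ⟨x, s, y, rfl⟩
      exact Submodule.subset_span ⟨f x, s, y, by simp [hf]⟩))).toAddMonoidHom)
    fun c x y ↦ by
      change mk k S (f (c • x)) y = c • mk k S (f x) y
      rw [map_smul, smul_mk]

@[simp]
theorem mapLeft_mk [Algebra k C] [IsScalarTower k C X] [IsScalarTower k C X'] (f : X →ₗ[C] X')
    (hf : ∀ (s : S) x, f (op s • x) = op s • f x) (x : X) (y : Y) :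
    mapLeft Y f hf (mk k S x y) = mk k S (f x) y := rfl

theorem mapLeft_surjective [Algebra k C] [IsScalarTower k C X] [IsScalarTower k C X']
    (f : X →ₗ[C] X') (hf : ∀ (s : S) x, f (op s • x) = op s • f x) (h : Function.Surjective f) :
    Function.Surjective (mapLeft (k := k) Y f hf) := by
  intro z
  induction z using induction_on with
  | zero => exact ⟨0, map_zero _⟩
  | mk x y =>
    obtain ⟨x, rfl⟩ := h x
    exact ⟨mk k S x y, rfl⟩
  | add z z' h h' =>
    obtain ⟨a, rfl⟩ := h
    obtain ⟨b, rfl⟩ := h'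
    exact ⟨a + b, map_add _ _ _⟩

end Linear

/-! #### Right projective modules -/

section RightProjective

variable [Algebra k S]

variable (k S Y) in
/-- The map `(S ⊗_k X) ⊗_k Y → X ⊗_k Y`, `s ⊗ x ⊗ y ↦ x ⊗ s y`. -/
def transfer (W : Type u) [AddCommGroup W] [Module k W] [IsScalarTower k S Y] :
    (Sᵐᵒᵖ ⊗[k] W) ⊗[k] Y →ₗ[k] W ⊗[k] Y :=
  TensorProduct.lift (TensorProduct.lift (LinearMap.mk₂ k
    (fun t x ↦ (TensorProduct.mk k W Y x).comp (Algebra.lsmul k k Y (unop t)))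
    (fun _ _ _ ↦ by ext; simp [TensorProduct.tmul_add])
    (fun _ _ _ ↦ by ext; simp)
    (fun _ _ _ ↦ by ext; simp)
    (fun _ _ _ ↦ by ext; simp [TensorProduct.smul_tmul'])))

@[simp]
theorem transfer_tmul {W : Type u} [AddCommGroup W] [Module k W] [IsScalarTower k S Y] (t : Sᵐᵒᵖ)
    (x : W) (y : Y) :
    transfer k S Y W ((t ⊗ₜ x) ⊗ₜ y) = x ⊗ₜ (unop t • y) := by
  simp [transfer]

theorem transfer_balanced {W : Type u} [AddCommGroup W] [Module k W] [IsScalarTower k S Y]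
    (w : Sᵐᵒᵖ ⊗[k] W) (s : S) (y : Y) :
    transfer k S Y W ((op s • w) ⊗ₜ y) = transfer k S Y W (w ⊗ₜ (s • y)) := by
  induction w using TensorProduct.induction_on with
  | zero => simp
  | tmul t x => simp [TensorProduct.smul_tmul', mul_smul]
  | add w w' h h' => simp [TensorProduct.add_tmul, h, h']

variable (k S X) in
/-- A section of the action map `S ⊗_k X → X` of a projective right module. -/
def rightSection [IsScalarTower k Sᵐᵒᵖ X] [Module.Projective Sᵐᵒᵖ X] :
    X →ₗ[Sᵐᵒᵖ] Sᵐᵒᵖ ⊗[k] X :=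
  (freeCover_splits k Sᵐᵒᵖ X).choose

theorem freeCover_rightSection [IsScalarTower k Sᵐᵒᵖ X] [Module.Projective Sᵐᵒᵖ X] (x : X) :
    freeCover k Sᵐᵒᵖ X (rightSection k S X x) = x :=
  (freeCover_splits k Sᵐᵒᵖ X).choose_spec x

variable [IsScalarTower k S Y] [IsScalarTower k Sᵐᵒᵖ X] [Module.Projective Sᵐᵒᵖ X]

variable (k S X Y) in
/-- For `X` projective on the right, a section of `X ⊗_k Y → X ⊗_S Y` which is natural in `Y`. -/
def incl : BalTensor k S X Y →+ X ⊗[k] Y :=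
  -- If the section sends `x` to `∑ sᵢ ⊗ xᵢ`, the map is `x ⊗ y ↦ ∑ xᵢ ⊗ sᵢ y`; right linearity of
  -- the section makes it balanced.
  lift ((transfer k S Y X).comp (((rightSection k S X).restrictScalars k).rTensor Y))
    fun x s y ↦ by simp [transfer_balanced]

theorem incl_mk (x : X) (y : Y) :
    incl k S X Y (mk k S x y) = transfer k S Y X (rightSection k S X x ⊗ₜ y) := rfl

theorem proj_incl (z : BalTensor k S X Y) : proj k S X Y (incl k S X Y z) = z := by
  refine DFunLike.congr_fun (addHom_ext (f := (proj k S X Y).comp (incl k S X Y))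
    (g := .id _) fun x y ↦ ?_) z
  have key (w : Sᵐᵒᵖ ⊗[k] X) : proj k S X Y (transfer k S Y X (w ⊗ₜ y)) =
      mk k S (freeCover k Sᵐᵒᵖ X w) y := by
    induction w using TensorProduct.induction_on with
    | zero => simp [zero_mk]
    | tmul t x => simpa [proj_tmul] using (mk_balanced k S x (unop t) y).symm
    | add w w' h h' => simp [TensorProduct.add_tmul, h, h', add_mk]
  simp [incl_mk, key, freeCover_rightSection]

variable {C : Type*} [Ring C] [Module C X] [SMulCommClass C k X] [SMulCommClass C Sᵐᵒᵖ X]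
variable {Y' Y'' : Type u} [AddCommGroup Y'] [Module k Y'] [Module S Y'] [IsScalarTower k S Y']
  [AddCommGroup Y''] [Module k Y''] [Module S Y''] [IsScalarTower k S Y'']

/-- Naturality makes `X ⊗_S -` a natural retract of the exact functor `X ⊗_k -`; injectivity and
exactness of `mapRight` follow. -/
theorem incl_mapRight (g : Y →ₗ[S] Y') (z : BalTensor k S X Y) :
    incl k S X Y' (mapRight X C g z) = (g.restrictScalars k).lTensor X (incl k S X Y z) := by
  refine DFunLike.congr_fun (addHom_ext (f := (incl k S X Y').comp (mapRight X C g).toAddMonoidHom)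
    (g := ((g.restrictScalars k).lTensor X).toAddMonoidHom.comp (incl k S X Y)) fun x y ↦ ?_) z
  have key (w : Sᵐᵒᵖ ⊗[k] X) : transfer k S Y' X (w ⊗ₜ g y) =
      (g.restrictScalars k).lTensor X (transfer k S Y X (w ⊗ₜ y)) := by
    induction w using TensorProduct.induction_on with
    | zero => simp
    | tmul t x => simp
    | add w w' h h' => simp [TensorProduct.add_tmul, h, h']
  simp [incl_mk, key]

theorem mapRight_injective (g : Y →ₗ[S] Y') (hg : Function.Injective g) :
    Function.Injective (mapRight (k := k) X C g) := by
  intro z z' h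
  have := congrArg (incl k S X Y') h
  rw [incl_mapRight, incl_mapRight] at this
  have := Module.Flat.lTensor_preserves_injective_linearMap (M := X) (g.restrictScalars k) hg this
  rw [← proj_incl z, this, proj_incl]

theorem mapRight_exact (g : Y →ₗ[S] Y') (g' : Y' →ₗ[S] Y'') (hg : Function.Exact g g') :
    Function.Exact (mapRight (k := k) X C g) (mapRight X C g') := by
  intro z
  constructor
  · intro h
    have := congrArg (incl k S X Y'') h
    rw [incl_mapRight, map_zero] at this
    obtain ⟨t, ht⟩ := (Module.Flat.lTensor_exact X (f := g.restrictScalars k)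
      (g := g'.restrictScalars k) hg _).1 this
    exact ⟨proj k S X Y t, by rw [mapRight_proj, ht, proj_incl]⟩
  · rintro ⟨z, rfl⟩
    refine DFunLike.congr_fun (addHom_ext
      (f := (mapRight X C g').toAddMonoidHom.comp (mapRight X C g).toAddMonoidHom)
      (g := 0) fun x y ↦ ?_) z
    simp [hg.apply_apply_eq_zero, mk_zero]

variable (k S X Y) in
-- The maps `incl` and `proj` are `D`-linear, so `X ⊗_S Y` is a retract of `X ⊗_k Y`, which is
-- projective over `Dᵐᵒᵖ` as a direct sum of copies of `Y`. The factors are swapped so that `D` acts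
-- on the first one.
theorem projective_right {D : Type*} [Ring D] [Algebra k D] [Module Dᵐᵒᵖ Y]
    [IsScalarTower k Dᵐᵒᵖ Y] [SMulCommClass Dᵐᵒᵖ S Y] [Module.Projective Dᵐᵒᵖ Y] :
    Module.Projective Dᵐᵒᵖ (BalTensor k S X Y) := by
  let c : X ⊗[k] Y ≃ₗ[k] Y ⊗[k] X := TensorProduct.comm k X Y
  have hinc (d : Dᵐᵒᵖ) (z : BalTensor k S X Y) :
      c (incl k S X Y (d • z)) = d • c (incl k S X Y z) := by
    refine DFunLike.congr_fun (addHom_ext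
      (f := c.toLinearMap.toAddMonoidHom.comp ((incl k S X Y).comp (rightMul d)))
      (g := (DistribSMul.toAddMonoidHom _ d).comp
        (c.toLinearMap.toAddMonoidHom.comp (incl k S X Y))) fun x y ↦ ?_) z
    have key (w : Sᵐᵒᵖ ⊗[k] X) : c (transfer k S Y X (w ⊗ₜ (d • y))) =
        d • c (transfer k S Y X (w ⊗ₜ y)) := by
      induction w using TensorProduct.induction_on with
      | zero => simp
      | tmul t x => simp [c, TensorProduct.smul_tmul', smul_comm d (unop t) y]
      | add w w' h h' => simp [TensorProduct.add_tmul, h, h']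
    simp [rightMul_mk, incl_mk, key]
  have hproj (d : Dᵐᵒᵖ) (t : Y ⊗[k] X) :
      proj k S X Y (c.symm (d • t)) = d • proj k S X Y (c.symm t) := by
    induction t using TensorProduct.induction_on with
    | zero => simp
    | tmul y x => simp [c, TensorProduct.smul_tmul', proj_tmul, op_smul_mk]
    | add w w' h h' => simp [h, h']
  let i : BalTensor k S X Y →ₗ[Dᵐᵒᵖ] Y ⊗[k] X :=
    { toFun z := c (incl k S X Y z), map_add' := by simp, map_smul' := hinc }
  let r : Y ⊗[k] X →ₗ[Dᵐᵒᵖ] BalTensor k S X Y :=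
    { toFun t := proj k S X Y (c.symm t), map_add' := by simp, map_smul' := hproj }
  exact Module.Projective.of_split i r (by ext z; simp [i, r, proj_incl])

end RightProjective

end BalTensor

end

end ProjBounded

namespace ProjBounded

noncomputable section

namespace BalTensor

variable {k : Type w} [Field k]

/-! #### Unit and associativity -/

section Unit

variable (k) (S : Type u) [Ring S] [Algebra k S]
variable (C : Type*) [Ring C] [Module C S] [SMulCommClass C k S] [SMulCommClass C Sᵐᵒᵖ S]
variable (Y : Type u) [AddCommGroup Y] [Module k Y] [Module S Y] [IsScalarTower k S Y]
  [Module C Y] [IsScalarTower C S Y]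

/-- `S ⊗_S Y ≅ Y`. -/
def unitEquiv : BalTensor k S S Y ≃ₗ[C] Y where
  __ := toLinear (lift (TensorProduct.lift (Algebra.lsmul k k Y).toLinearMap)
    (fun x s y ↦ by
      change (x * s) • y = x • s • y
      rw [mul_smul])) (fun c x y ↦ by
        change (c • x) • y = c • x • y
        rw [smul_assoc])
  invFun y := mk k S 1 y
  left_inv z := by
    induction z using induction_on with
    | zero => simp [mk_zero]
    | mk x y => simp [← mk_balanced]
    | add z z' h h' => simp_all [mk_add]
  right_inv y := by simp

@[simp]
theorem unitEquiv_mk (s : S) (y : Y) : unitEquiv k S C Y (mk k S s y) = s • y := by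
  simp [unitEquiv]

end Unit

section Assoc

variable {S : Type u} [Ring S] [Algebra k S] {D : Type u} [Ring D] [Algebra k D]
variable {X : Type u} [AddCommGroup X] [Module k X] [Module Sᵐᵒᵖ X] [IsScalarTower k Sᵐᵒᵖ X]
variable {Z : Type u} [AddCommGroup Z] [Module k Z] [Module S Z] [Module Dᵐᵒᵖ Z]
  [IsScalarTower k S Z] [IsScalarTower k Dᵐᵒᵖ Z] [SMulCommClass S Dᵐᵒᵖ Z]
  [SMulCommClass Dᵐᵒᵖ S Z]
variable {M : Type u} [AddCommGroup M] [Module k M] [Module D M]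
variable {C : Type*} [Ring C] [Module C X] [SMulCommClass C k X] [SMulCommClass C Sᵐᵒᵖ X]

variable (k D Z) in
/-- The map `z ↦ z ⊗ m`. -/
def mkRight (m : M) : Z →ₗ[S] BalTensor k D Z M where
  toFun z := mk k D z m
  map_add' z z' := add_mk k D z z' m
  map_smul' s z := (smul_mk s z m).symm

variable (k S Z) in
/-- The map `z ↦ x ⊗ z`. -/
def mkLeft (x : X) : Z →ₗ[k] BalTensor k S X Z where
  toFun z := mk k S x z
  map_add' z z' := mk_add k S x z z'
  map_smul' c z := by rw [← smul_mk_eq, smul_mk, RingHom.id_apply]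

/-- The map `(x ⊗ z) ⊗ m ↦ x ⊗ (z ⊗ m)`. -/
def assocHom : BalTensor k D (BalTensor k S X Z) M →ₗ[C] BalTensor k S X (BalTensor k D Z M) :=
  toLinear (lift (TensorProduct.lift (LinearMap.mk₂ k
      (fun (w : BalTensor k S X Z) (m : M) ↦ mapRight X k (mkRight k D Z m) w)
      (fun _ _ _ ↦ map_add _ _ _) (fun _ _ _ ↦ map_smul _ _ _)
      (fun w m m' ↦ by
        induction w using induction_on with
        | zero => simp
        | mk x z => simp [mkRight, mk_add]
        | add w w' h h' => simp only [map_add, h, h']; abel)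
      (fun c m w ↦ by
        induction m using induction_on with
        | zero => simp
        | mk x z =>
          change mk k S x (mk k D z (c • w)) = c • mk k S x (mk k D z w)
          rw [← smul_mk_eq, ← smul_mk, ← smul_mk_eq k S, smul_mk]
        | add w w' h h' => simp only [map_add, smul_add, h, h'])))
    (fun w d m ↦ by
      induction w using induction_on with
      | zero => simp
      | mk x z => simp [mkRight, mk_balanced, op_smul_mk]
      | add w w' h h' => simp_all [TensorProduct.add_tmul]))
    (fun c w m ↦ by
      induction w using induction_on with
      | zero => simp [zero_mk]
      | mk x z => simp [smul_mk]
      | add w w' h h' => simp_all [add_mk])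

@[simp]
theorem assocHom_mk (x : X) (z : Z) (m : M) :
    assocHom (C := C) (mk k D (mk k S x z) m) = mk k S x (mk k D z m) := by
  simp [assocHom, mkRight]

/-- The map `x ⊗ (z ⊗ m) ↦ (x ⊗ z) ⊗ m`. -/
def assocInv : BalTensor k S X (BalTensor k D Z M) →ₗ[C] BalTensor k D (BalTensor k S X Z) M :=
  toLinear (lift (TensorProduct.lift (LinearMap.mk₂ k
      (fun (x : X) (w : BalTensor k D Z M) ↦ mapLeft M (mkLeft k S Z x) (fun _ _ ↦ rfl) w)
      (fun x x' w ↦ by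
        induction w using induction_on with
        | zero => simp
        | mk x z => simp [mkLeft, add_mk]
        | add w w' h h' => simp only [map_add, h, h']; abel)
      (fun c x w ↦ by
        induction w using induction_on with
        | zero => simp
        | mk x z => simp [mkLeft, smul_mk]
        | add w w' h h' => simp only [map_add, smul_add, h, h'])
      (fun _ _ _ ↦ map_add _ _ _) (fun _ _ _ ↦ map_smul _ _ _)))
    (fun x s w ↦ by
      induction w using induction_on with
      | zero => simp
      | mk z m => simp [mkLeft, mk_balanced, smul_mk]
      | add w w' h h' => simp_all [TensorProduct.tmul_add]))
    (fun c x w ↦ by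
      induction w using induction_on with
      | zero => simp [mk_zero]
      | mk z m => simp [mkLeft, smul_mk]
      | add w w' h h' => simp_all [mk_add])

@[simp]
theorem assocInv_mk (x : X) (z : Z) (m : M) :
    assocInv (C := C) (mk k S x (mk k D z m)) = mk k D (mk k S x z) m := by
  simp [assocInv, mkLeft]

variable (k S D X Z M C) in
/-- `(X ⊗_S Z) ⊗_D M ≅ X ⊗_S (Z ⊗_D M)`. -/
def assoc : BalTensor k D (BalTensor k S X Z) M ≃ₗ[C] BalTensor k S X (BalTensor k D Z M) where
  __ := assocHom
  invFun := assocInv (C := C)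
  left_inv t := by
    induction t using induction_on with
    | zero => simp
    | mk w m =>
      induction w using induction_on with
      | zero => simp [zero_mk]
      | mk x z => simp
      | add w w' h h' => simp_all [add_mk]
    | add w w' h h' => simp_all
  right_inv t := by
    induction t using induction_on with
    | zero => simp
    | mk x w =>
      induction w using induction_on with
      | zero => simp [mk_zero]
      | mk x z => simp
      | add w w' h h' => simp_all [mk_add]
    | add w w' h h' => simp_all

end Assoc

/-! #### Free modules -/

section Free

variable (k) (S : Type u) [Ring S] [Algebra k S]
variable (X : Type u) [AddCommGroup X] [Module k X] [Module Sᵐᵒᵖ X] [IsScalarTower k Sᵐᵒᵖ X]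
variable (C : Type*) [Ring C] [Algebra k C] [Module C X] [IsScalarTower k C X]
  [SMulCommClass C Sᵐᵒᵖ X]
variable (V : Type u) [AddCommGroup V] [Module k V]

/-- The map `X ⊗_S (S ⊗_k V) → X ⊗_k V`. -/
def freeHom : BalTensor k S X (S ⊗[k] V) →ₗ[C] X ⊗[k] V :=
  toLinear (lift (TensorProduct.lift (LinearMap.mk₂ k
      (fun (x : X) (w : S ⊗[k] V) ↦ TensorProduct.map
        ((LinearMap.toSpanSingleton Sᵐᵒᵖ X x).restrictScalars k ∘ₗ
          (opLinearEquiv k : S ≃ₗ[k] Sᵐᵒᵖ).toLinearMap) LinearMap.id w)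
      (fun x x' w ↦ by
        induction w using TensorProduct.induction_on with
        | zero => simp
        | tmul x z => simp [TensorProduct.add_tmul]
        | add w w' h h' => simp only [map_add, h, h']; abel)
      (fun c x w ↦ by
        induction w using TensorProduct.induction_on with
        | zero => simp
        | tmul s z => simp [TensorProduct.smul_tmul', smul_comm (op s) c x]
        | add w w' h h' => simp only [map_add, smul_add, h, h'])
      (fun _ _ _ ↦ map_add _ _ _) (fun _ _ _ ↦ map_smul _ _ _)))
    (fun x s w ↦ by
      induction w using TensorProduct.induction_on with
      | zero => simp
      | tmul z m => simp [mul_smul, TensorProduct.smul_tmul']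
      | add w w' h h' => simp_all [TensorProduct.tmul_add]))
    (fun c x w ↦ by
      induction w using TensorProduct.induction_on with
      | zero => simp [mk_zero]
      | tmul s m => simp [TensorProduct.smul_tmul', smul_comm c (op s) x]
      | add w w' h h' => simp_all [mk_add])

@[simp]
theorem freeHom_mk (x : X) (s : S) (v : V) :
    freeHom k S X C V (mk k S x (s ⊗ₜ v)) = (op s • x) ⊗ₜ v := by
  simp [freeHom]

/-- `X ⊗_S (S ⊗_k V) ≅ X ⊗_k V`. -/
def freeEquiv : BalTensor k S X (S ⊗[k] V) ≃ₗ[C] X ⊗[k] V where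
  __ := freeHom k S X C V
  invFun := TensorProduct.lift (LinearMap.mk₂ k (fun (x : X) (v : V) ↦ mk k S x ((1 : S) ⊗ₜ v))
    (fun _ _ _ ↦ add_mk _ _ _ _ _) (fun _ _ _ ↦ (smul_mk _ _ _).symm)
    (fun _ _ _ ↦ by rw [TensorProduct.tmul_add, mk_add])
    (fun _ _ _ ↦ by rw [TensorProduct.tmul_smul, ← smul_mk_eq, smul_mk]))
  left_inv t := by
    induction t using induction_on with
    | zero => simp
    | mk x w =>
      induction w using TensorProduct.induction_on with
      | zero => simp [mk_zero]
      | tmul s v => simp [mk_balanced, TensorProduct.smul_tmul']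
      | add w w' h h' => simp_all [mk_add]
    | add w w' h h' => simp_all
  right_inv t := by
    induction t using TensorProduct.induction_on with
    | zero => simp
    | tmul x v => simp
    | add w w' h h' => simp_all

end Free

end BalTensor

end

end ProjBounded

namespace ProjBounded

noncomputable section

/-! ### Bounds for the projective dimension -/

section PdLE

variable (R : Type u) [Ring R] (X : Type u) [AddCommGroup X] [Module R X]

/-- The `R`-module `X` has projective dimension at most `d`. -/
def PdLE (d : ℕ) : Prop := HasProjectiveDimensionLE (ModuleCat.of R X) d

theorem pdLE_zero_iff : PdLE R X 0 ↔ Module.Projective R X := by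
  rw [PdLE, ← projective_iff_hasProjectiveDimensionLE_zero, ← IsProjective.iff_projective]

variable {R X} {Y Z : Type u} [AddCommGroup Y] [Module R Y] [AddCommGroup Z] [Module R Z]

theorem PdLE.mono {d e : ℕ} (h : PdLE R X d) (hde : d ≤ e) : PdLE R X e :=
  have : HasProjectiveDimensionLT (ModuleCat.of R X) (d + 1) := h
  hasProjectiveDimensionLT_of_ge _ (d + 1) _ (by omega)

theorem PdLE.of_retract {d : ℕ} (h : PdLE R Y d) (i : X →ₗ[R] Y) (r : Y →ₗ[R] X)
    (hri : ∀ x, r (i x) = x) : PdLE R X d :=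
  have : HasProjectiveDimensionLT (ModuleCat.of R Y) (d + 1) := h
  Retract.hasProjectiveDimensionLT (Y := ModuleCat.of R Y)
    { i := ModuleCat.ofHom i, r := ModuleCat.ofHom r, retract := by ext x; exact hri x } (d + 1)

theorem PdLE.of_equiv {d : ℕ} (h : PdLE R Y d) (e : X ≃ₗ[R] Y) : PdLE R X d :=
  h.of_retract e.toLinearMap e.symm.toLinearMap (by simp)

variable {f : X →ₗ[R] Y} {g : Y →ₗ[R] Z}

theorem shortExact_of_exact (hf : Function.Injective f) (hfg : Function.Exact f g)
    (hg : Function.Surjective g) :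
    (ShortComplex.mk (ModuleCat.ofHom f) (ModuleCat.ofHom g) (by
      ext x; exact hfg.apply_apply_eq_zero x)).ShortExact where
  exact := (ShortComplex.ShortExact.moduleCat_exact_iff_function_exact _).2 hfg
  mono_f := (ModuleCat.mono_iff_injective _).2 hf
  epi_g := (ModuleCat.epi_iff_surjective _).2 hg

/-- The names `third`, `second` and `first` refer to the term of the short exact sequence whose
dimension is bounded. -/
theorem PdLE.third {d : ℕ} (h₁ : PdLE R X d) (h₂ : PdLE R Y (d + 1)) (hf : Function.Injective f)
    (hfg : Function.Exact f g) (hg : Function.Surjective g) : PdLE R Z (d + 1) :=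
  (shortExact_of_exact hf hfg hg).hasProjectiveDimensionLT_X₃ (d + 1) h₁ h₂

theorem PdLE.second {d : ℕ} (h₁ : PdLE R X d) (h₃ : PdLE R Z d) (hf : Function.Injective f)
    (hfg : Function.Exact f g) (hg : Function.Surjective g) : PdLE R Y d :=
  (shortExact_of_exact hf hfg hg).hasProjectiveDimensionLT_X₂ (d + 1) h₁ h₃

theorem PdLE.first {d : ℕ} (h₂ : PdLE R Y d) (h₃ : PdLE R Z (d + 1)) (hf : Function.Injective f)
    (hfg : Function.Exact f g) (hg : Function.Surjective g) : PdLE R X d :=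
  (shortExact_of_exact hf hfg hg).hasProjectiveDimensionLT_X₁ (d + 1) h₂ h₃

end PdLE

section FreeCover

variable (k : Type w) [Field k] (R : Type u) [Ring R] [Algebra k R]
variable (X : Type u) [AddCommGroup X] [Module k X] [Module R X] [IsScalarTower k R X]

variable {R X} in
theorem PdLE.exists_syzygy {d : ℕ} (h : PdLE R X (d + 1)) :
    ∃ (K : Type u) (_ : AddCommGroup K) (_ : Module k K) (_ : Module R K)
      (_ : IsScalarTower k R K) (i : K →ₗ[R] R ⊗[k] X), Function.Injective i ∧
        Function.Exact i (freeCover k R X) ∧ PdLE R K d :=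
  ⟨LinearMap.ker (freeCover k R X), inferInstance, inferInstance, inferInstance, inferInstance,
    (LinearMap.ker _).subtype, (LinearMap.ker _).injective_subtype,
    LinearMap.exact_subtype_ker_map _,
    (((pdLE_zero_iff R (R ⊗[k] X)).2 inferInstance).mono d.zero_le).first h
      (LinearMap.ker _).injective_subtype (LinearMap.exact_subtype_ker_map _)
      (freeCover_surjective k R X)⟩

end FreeCover

/-! ### Projective dimension of tensor products -/

section Tensor

variable {k : Type w} [Field k] {R : Type u} [Ring R] [Algebra k R]

theorem PdLE.tensor (V : Type u) [AddCommGroup V] [Module k V] {d : ℕ} :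
    ∀ {X : Type u} [AddCommGroup X] [Module k X] [Module R X] [IsScalarTower k R X],
      PdLE R X d → PdLE R (X ⊗[k] V) d := by
  induction d with
  | zero =>
    intro X _ _ _ _ h
    rw [pdLE_zero_iff] at h ⊢
    infer_instance
  | succ d ih =>
    intro X _ _ _ _ h
    obtain ⟨K, _, _, _, _, i, hi, hex, hK⟩ := h.exists_syzygy k
    exact (ih hK).third
      (((pdLE_zero_iff R ((R ⊗[k] X) ⊗[k] V)).2 inferInstance).mono (d + 1).zero_le)
      (f := TensorProduct.AlgebraTensorModule.map i .id)
      (g := TensorProduct.AlgebraTensorModule.map (freeCover k R X) .id)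
      (Module.Flat.rTensor_preserves_injective_linearMap (i.restrictScalars k) hi)
      (rTensor_exact V (f := i.restrictScalars k) (g := (freeCover k R X).restrictScalars k) hex
        (freeCover_surjective k R X))
      (LinearMap.rTensor_surjective V (g := (freeCover k R X).restrictScalars k)
        (freeCover_surjective k R X))

variable {S : Type u} [Ring S] [Algebra k S]
variable {X : Type u} [AddCommGroup X] [Module k X] [Module Sᵐᵒᵖ X] [IsScalarTower k Sᵐᵒᵖ X]
  [Module R X] [IsScalarTower k R X] [SMulCommClass R Sᵐᵒᵖ X]

open BalTensor in
/-- For a bimodule `X` which is projective on the right,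
`pd (X ⊗_S Y) ≤ pd X + pd Y`, where `X` is regarded as a left module. -/
theorem PdLE.balTensor [Module.Projective Sᵐᵒᵖ X] {d : ℕ} (hX : PdLE R X d) {e : ℕ} :
    ∀ {Y : Type u} [AddCommGroup Y] [Module k Y] [Module S Y] [IsScalarTower k S Y],
      PdLE S Y e → PdLE R (BalTensor k S X Y) (d + e) := by
  -- On the free modules `S ⊗_k V` the functor is `X ⊗_k V`, which costs only `pd X`; general `Y` is
  -- reached by free covers.
  have free (V : Type u) [AddCommGroup V] [Module k V] : PdLE R (BalTensor k S X (S ⊗[k] V)) d :=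
    (hX.tensor V).of_equiv (freeEquiv k S X R V)
  induction e with
  | zero =>
    intro Y _ _ _ _ h
    rw [pdLE_zero_iff] at h
    obtain ⟨s, hs⟩ := freeCover_splits k S Y
    refine (free Y).of_retract (mapRight X R s) (mapRight X R (freeCover k S Y)) fun z ↦ ?_
    refine LinearMap.congr_fun (linearMap_ext
      (f := (mapRight X R (freeCover k S Y)).comp (mapRight X R s)) (g := .id) fun x y ↦ ?_) z
    simpa using congrArg (mk k S x) (hs y)
  | succ e ih =>
    intro Y _ _ _ _ h
    obtain ⟨K, _, _, _, _, i, hi, hex, hK⟩ := h.exists_syzygy k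
    exact (ih hK).third ((free Y).mono (by omega)) (mapRight_injective i hi)
      (mapRight_exact i _ hex)
      (mapRight_surjective _ (freeCover_surjective k S Y))

instance projective_op_self : Module.Projective Sᵐᵒᵖ S :=
  .of_equiv
    ({ opAddEquiv.symm with
      map_smul' := fun _ _ ↦ rfl } : Sᵐᵒᵖ ≃ₗ[Sᵐᵒᵖ] S)

/-- Restriction of scalars along `R → S`, where the action of `R` on `S` is given by a bimodule
structure. -/
theorem PdLE.restrict [Module R S] [IsScalarTower k R S] [SMulCommClass R Sᵐᵒᵖ S] {d e : ℕ}
    (hS : PdLE R S d) {Y : Type u} [AddCommGroup Y] [Module k Y] [Module S Y]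
    [IsScalarTower k S Y] [Module R Y] [IsScalarTower R S Y] (hY : PdLE S Y e) :
    PdLE R Y (d + e) :=
  (hS.balTensor (k := k) hY).of_equiv (BalTensor.unitEquiv k S R Y).symm

end Tensor

end

end ProjBounded

namespace ProjBounded

noncomputable section

/-! ### Relative homological algebra -/

section Relative

variable {S R : Type u} [Ring S] [Ring R] {f : S →+* R}

/-- Homomorphisms out of a relatively projective module lift along relatively split surjections. -/
theorem IsRelProjective.exists_lift {P : ModuleCat.{u} R} (hP : IsRelProjective f P)
    {E X : ModuleCat.{u} R} (p : E ⟶ X) (hp : IsSplitEpi ((ModuleCat.restrictScalars f).map p))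
    (h : P ⟶ X) : ∃ l : P ⟶ E, l ≫ p = h := by
  -- `L` is the pullback of `p` along `h`. Its projection to `P` inherits an `S`-splitting from that
  -- of `p`, so relative projectivity splits it over `R`.
  let L : Submodule R (E × P) :=
    LinearMap.eqLocus (p.hom ∘ₗ LinearMap.fst R E P) (h.hom ∘ₗ LinearMap.snd R E P)
  let g : ModuleCat.of R L ⟶ P := ModuleCat.ofHom (LinearMap.snd R E P ∘ₗ L.subtype)
  obtain ⟨⟨σ, hσ⟩⟩ := hp
  have hσ' (x : X) : p.hom (σ.hom x) = x := congr($hσ x)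
  let τ : (ModuleCat.restrictScalars f).obj P ⟶
      (ModuleCat.restrictScalars f).obj (ModuleCat.of R L) :=
    ModuleCat.ofHom (X := (ModuleCat.restrictScalars f).obj P)
      (Y := (ModuleCat.restrictScalars f).obj (ModuleCat.of R L))
      { toFun x := (⟨(σ.hom (h.hom x), x), hσ' _⟩ : L)
        map_add' x y := Subtype.ext (Prod.ext
          ((congrArg σ.hom (map_add h.hom x y)).trans (map_add σ.hom _ _)) rfl)
        map_smul' s x := Subtype.ext (Prod.ext
          ((congrArg σ.hom (map_smul h.hom (f s) x)).trans (map_smul σ.hom s _)) rfl) }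
  obtain ⟨⟨s, hs⟩⟩ := hP _ g ⟨⟨τ, by ext x; rfl⟩⟩
  refine ⟨s ≫ ModuleCat.ofHom (LinearMap.fst R E P ∘ₗ L.subtype), ?_⟩
  ext x
  have h1 : p.hom (s.hom x).1.1 = h.hom (s.hom x).1.2 := (s.hom x).2
  have h2 : (s.hom x).1.2 = x := congr($hs x)
  rw [h2] at h1
  exact h1

variable (f) in
/-- `K` is a retract of the direct sum of `Z` and a relatively projective module. -/
def StableRetract (K Z : ModuleCat.{u} R) : Prop :=
  ∃ (W : ModuleCat.{u} R) (φ : K ⟶ Z) (ψ : Z ⟶ K) (a : K ⟶ W) (b : W ⟶ K),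
    IsRelProjective f W ∧ φ ≫ ψ + a ≫ b = 𝟙 K

/-- The module `W` enters with zero maps, so any relatively projective module will do. -/
theorem StableRetract.refl {K : ModuleCat.{u} R} {W : ModuleCat.{u} R}
    (hW : IsRelProjective f W) : StableRetract f K K :=
  ⟨W, 𝟙 K, 𝟙 K, 0, 0, hW, by simp⟩

/-- Stable retracts pass to relative syzygies. -/
theorem StableRetract.syzygy {K Z K' Z' T P : ModuleCat.{u} R} (h : StableRetract f K Z)
    (hT : IsRelProjective f T) (hP : IsRelProjective f P)
    {i : K' ⟶ T} {q : T ⟶ K} {wq : i ≫ q = 0} (hq : (ShortComplex.mk i q wq).ShortExact)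
    (hq' : IsSplitEpi ((ModuleCat.restrictScalars f).map q))
    {j : Z' ⟶ P} {p : P ⟶ Z} {wp : j ≫ p = 0} (hp : (ShortComplex.mk j p wp).ShortExact)
    (hp' : IsSplitEpi ((ModuleCat.restrictScalars f).map p)) : StableRetract f K' Z' := by
  obtain ⟨W, φ, ψ, a, b, hW, h⟩ := h
  -- Relative projectivity of the covers lifts `φ`, `ψ` and `b` to the middle terms; the first two
  -- then restrict to the kernels.
  obtain ⟨φ₁, hφ⟩ := hT.exists_lift p hp' (q ≫ φ)
  obtain ⟨ψ₁, hψ⟩ := hP.exists_lift q hq' (p ≫ ψ)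
  obtain ⟨b₁, hb⟩ := hW.exists_lift q hq' b
  have : Mono i := hq.mono_f
  have : Mono j := hp.mono_f
  obtain ⟨φ', hφ'⟩ : ∃ φ' : K' ⟶ Z', φ' ≫ j = i ≫ φ₁ :=
    ⟨hp.exact.lift (i ≫ φ₁) (by simp [hφ, reassoc_of% wq]), hp.exact.lift_f _ _⟩
  obtain ⟨ψ', hψ'⟩ : ∃ ψ' : Z' ⟶ K', ψ' ≫ i = j ≫ ψ₁ :=
    ⟨hq.exact.lift (j ≫ ψ₁) (by simp [hψ, reassoc_of% wp]), hq.exact.lift_f _ _⟩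
  -- The endomorphism on the right is killed by `q`, because `φ ≫ ψ + a ≫ b = 𝟙`. It therefore lands
  -- in `K'`, and `T` with the maps `i`, `e` is the new relatively projective part.
  obtain ⟨e, he⟩ : ∃ e : T ⟶ K', e ≫ i = 𝟙 T - φ₁ ≫ ψ₁ - q ≫ a ≫ b₁ :=
    ⟨hq.exact.lift (𝟙 T - φ₁ ≫ ψ₁ - q ≫ a ≫ b₁) (by
      have := q ≫= h
      simp only [Preadditive.comp_add, Category.comp_id] at this
      simp only [Preadditive.sub_comp, Category.id_comp, Category.assoc, hψ, hb]
      rw [reassoc_of% hφ, sub_sub, sub_eq_zero]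
      exact this.symm), hq.exact.lift_f _ _⟩
  refine ⟨T, φ', ψ', i, e, hT, ?_⟩
  rw [← cancel_mono i]
  simp [Preadditive.add_comp, Preadditive.comp_sub, hψ', he, reassoc_of% hφ', reassoc_of% wq]

/-- When `Z = 0` the identity of `K` factors through the relatively projective `W`, and lifting `b`
along `q` yields the section. -/
theorem StableRetract.exists_section {K Z T : ModuleCat.{u} R} (h : StableRetract f K Z)
    (hZ : Subsingleton Z) (q : T ⟶ K)
    (hq : IsSplitEpi ((ModuleCat.restrictScalars f).map q)) : ∃ s : K ⟶ T, s ≫ q = 𝟙 K := by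
  obtain ⟨W, φ, ψ, a, b, hW, h⟩ := h
  obtain ⟨b₁, hb⟩ := hW.exists_lift q hq b
  refine ⟨a ≫ b₁, ?_⟩
  have : φ = 0 := by
    ext x
    exact Subsingleton.elim _ _
  simpa [this, hb] using h

variable (f) in
/-- `Z` has a relatively projective resolution with `n` terms. -/
def RelDimLT : ℕ → ModuleCat.{u} R → Prop
  | 0, Z => Subsingleton Z
  | n + 1, Z => ∃ (Z' P : ModuleCat.{u} R) (j : Z' ⟶ P) (p : P ⟶ Z) (w : j ≫ p = 0),
      (ShortComplex.mk j p w).ShortExact ∧ IsSplitEpi ((ModuleCat.restrictScalars f).map p) ∧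
        IsRelProjective f P ∧ RelDimLT n Z'

theorem ker_shortExact {P Z : ModuleCat.{u} R} (p : P ⟶ Z) (hp : Function.Surjective p.hom) :
    (ShortComplex.mk (ModuleCat.ofHom (LinearMap.ker p.hom).subtype) p (by
      ext x; exact x.2)).ShortExact :=
  shortExact_of_exact (LinearMap.ker p.hom).injective_subtype
    (LinearMap.exact_subtype_ker_map p.hom) hp

theorem exists_kernel {P Z : ModuleCat.{u} R} (p : P ⟶ Z) (hp : Function.Surjective p.hom) :
    ∃ (K : ModuleCat.{u} R) (i : K ⟶ P) (w : i ≫ p = 0), (ShortComplex.mk i p w).ShortExact ∧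
      Function.Injective i.hom ∧ Function.Exact i.hom p.hom :=
  ⟨_, _, _, ker_shortExact p hp, (LinearMap.ker p.hom).injective_subtype,
    LinearMap.exact_subtype_ker_map p.hom⟩

theorem KernelSplits.isSplitEpi {P Z : ModuleCat.{u} R} {p : P ⟶ Z} (hk : KernelSplits f p)
    (hp : Function.Surjective p.hom) : IsSplitEpi ((ModuleCat.restrictScalars f).map p) := by
  obtain ⟨L, hL⟩ := hk
  let p' := ((ModuleCat.restrictScalars f).map p).hom
  have hp' : Function.Surjective p' := hp
  let s := L.subtype ∘ₗ ((Submodule.quotientEquivOfIsCompl _ L hL).toLinearMap ∘ₗ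
    (p'.quotKerEquivOfSurjective hp').symm.toLinearMap)
  refine ⟨⟨ModuleCat.ofHom (X := (ModuleCat.restrictScalars f).obj Z)
    (Y := (ModuleCat.restrictScalars f).obj P) s, ?_⟩⟩
  ext z
  obtain ⟨y, rfl⟩ := (p'.quotKerEquivOfSurjective hp').surjective z
  obtain ⟨l, rfl⟩ := (Submodule.quotientEquivOfIsCompl _ L hL).symm.surjective y
  change p' (s _) = _
  simp [s]

theorem RelDimLT.succ {n : ℕ} {P Z : ModuleCat.{u} R} (p : P ⟶ Z)
    (hp : Function.Surjective p.hom) (hk : KernelSplits f p) (hP : IsRelProjective f P)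
    (h : RelDimLT f n (ModuleCat.of R (LinearMap.ker p.hom))) : RelDimLT f (n + 1) Z :=
  ⟨_, P, _, p, _, ker_shortExact p hp, hk.isSplitEpi hp, hP, h⟩

/-- One step of a resolution: `g` maps onto the kernel of `g'`. -/
theorem RelDimLT.ker_succ {n : ℕ} {P Q M : ModuleCat.{u} R} (g : P ⟶ Q) (g' : Q ⟶ M)
    (hgg : LinearMap.range g.hom = LinearMap.ker g'.hom) (hk : KernelSplits f g)
    (hP : IsRelProjective f P) (h : RelDimLT f n (ModuleCat.of R (LinearMap.ker g.hom))) :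
    RelDimLT f (n + 1) (ModuleCat.of R (LinearMap.ker g'.hom)) := by
  have hmem (x : P) : g.hom x ∈ LinearMap.ker g'.hom := hgg ▸ LinearMap.mem_range_self _ x
  let p : P ⟶ ModuleCat.of R (LinearMap.ker g'.hom) :=
    ModuleCat.ofHom (g.hom.codRestrict _ hmem)
  have hker : LinearMap.ker p.hom = LinearMap.ker g.hom := LinearMap.ker_codRestrict _ _ _
  refine RelDimLT.succ p ?_ ?_ hP (hker ▸ h)
  · rintro ⟨y, hy⟩
    rw [← hgg] at hy
    obtain ⟨x, rfl⟩ := hy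
    exact ⟨x, rfl⟩
  · have : LinearMap.ker ((ModuleCat.restrictScalars f).map p).hom =
        LinearMap.ker ((ModuleCat.restrictScalars f).map g).hom := by
      ext x
      exact SetLike.ext_iff.1 hker x
    rw [KernelSplits, this]
    exact hk

/-- The terms counted are `P 0, …, P (n + 1)`, the last being zero; allowing it spares a separate
treatment of `n = 0`. -/
theorem RelProjResolution.relDimLT {M : ModuleCat.{u} R} {n : ℕ} (r : RelProjResolution f M n) :
    RelDimLT f (n + 2) M := by
  have key (m : ℕ) : ∀ i, n < i + 1 + m →
      RelDimLT f m (ModuleCat.of R (LinearMap.ker (r.d i).hom)) := by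
    induction m with
    | zero =>
      intro i hi
      have := r.eq_zero (i + 1) hi
      exact inferInstanceAs (Subsingleton (LinearMap.ker (r.d i).hom))
    | succ m ih =>
      intro i hi
      exact .ker_succ _ _ (r.exact_succ i) (r.d_splits _) (r.relProjective _)
        (ih (i + 1) (by omega))
  exact .succ r.aug r.aug_surjective r.aug_splits (r.relProjective 0)
    (.ker_succ _ _ r.exact_zero (r.d_splits 0) (r.relProjective 1) (key n 0 (by omega)))

end Relative

end

end ProjBounded

namespace ProjBounded

noncomputable section

/-! ### Sequences of bimodules which split on the right -/

namespace BalTensor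

variable {k : Type w} [Field k] {S : Type u} [Ring S] [Algebra k S]
variable {C : Type*} [Ring C] [Algebra k C]
variable {X : Type u} [AddCommGroup X] [Module k X] [Module Sᵐᵒᵖ X] [IsScalarTower k Sᵐᵒᵖ X]
  [Module C X] [IsScalarTower k C X] [SMulCommClass C Sᵐᵒᵖ X]
variable {X' : Type u} [AddCommGroup X'] [Module k X'] [Module Sᵐᵒᵖ X'] [IsScalarTower k Sᵐᵒᵖ X']
  [Module C X'] [IsScalarTower k C X'] [SMulCommClass C Sᵐᵒᵖ X']
variable {X'' : Type u} [AddCommGroup X''] [Module k X''] [Module Sᵐᵒᵖ X'']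
  [IsScalarTower k Sᵐᵒᵖ X''] [Module C X''] [IsScalarTower k C X''] [SMulCommClass C Sᵐᵒᵖ X'']
variable (Y : Type u) [AddCommGroup Y] [Module k Y] [Module S Y]

/-- Projectivity of `X''` splits the sequence as right modules, and a split sequence survives
tensoring with any `Y`. The splitting need not respect `C`, so `ρY` and `σY` are only `k`-linear,
which is enough for exactness. -/
theorem mapLeft_injective_exact (i : X →ₗ[C] X') (hi : ∀ (s : S) x, i (op s • x) = op s • i x)
    (q : X' →ₗ[C] X'') (hq : ∀ (s : S) x, q (op s • x) = op s • q x)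
    (hinj : Function.Injective i) (hex : Function.Exact i q) (hsurj : Function.Surjective q)
    [Module.Projective Sᵐᵒᵖ X''] :
    Function.Injective (mapLeft (k := k) Y i hi) ∧
      Function.Exact (mapLeft (k := k) Y i hi) (mapLeft (k := k) Y q hq) := by
  let i' : X →ₗ[Sᵐᵒᵖ] X' := { i with map_smul' := fun s x ↦ hi (unop s) x }
  let q' : X' →ₗ[Sᵐᵒᵖ] X'' := { q with map_smul' := fun s x ↦ hq (unop s) x }
  obtain ⟨σ, hσ⟩ := Module.projective_lifting_property q' .id hsurj
  have hσ' (x : X'') : q (σ x) = x := LinearMap.congr_fun hσ x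
  let π : X' →ₗ[Sᵐᵒᵖ] X' := LinearMap.id - σ ∘ₗ q'
  have hmem (x : X') : π x ∈ LinearMap.range i' := by
    obtain ⟨y, hy⟩ := (hex (x - σ (q x))).1 (by rw [map_sub, hσ', sub_self])
    exact ⟨y, hy⟩
  let ρ : X' →ₗ[Sᵐᵒᵖ] X := (LinearEquiv.ofInjective i' hinj).symm.toLinearMap ∘ₗ
    π.codRestrict _ hmem
  have hρ (x : X') : i (ρ x) = x - σ (q x) :=
    congrArg Subtype.val ((LinearEquiv.ofInjective i' hinj).apply_symm_apply
      ⟨_, hmem x⟩)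
  have hρi (x : X) : ρ (i x) = x := hinj (by
    rw [hρ, hex.apply_apply_eq_zero, map_zero, sub_zero])
  let ρY := mapLeft (k := k) Y (ρ.restrictScalars k) fun s x ↦ map_smul ρ (op s) x
  let σY := mapLeft (k := k) Y (σ.restrictScalars k) fun s x ↦ map_smul σ (op s) x
  have h1 (z : BalTensor k S X Y) : ρY (mapLeft Y i hi z) = z := by
    induction z using induction_on with
    | zero => simp
    | mk x y => exact congrArg (mk k S · y) (hρi x)
    | add z z' h h' => simp [h, h']
  have h2 (z : BalTensor k S X' Y) : mapLeft Y i hi (ρY z) + σY (mapLeft Y q hq z) = z := by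
    induction z using induction_on with
    | zero => simp
    | mk x y =>
      change mk k S (i (ρ x)) y + mk k S (σ (q x)) y = mk k S x y
      rw [hρ, ← add_mk, sub_add_cancel]
    | add z z' h h' =>
      conv_rhs => rw [← h, ← h']
      simp only [map_add]
      abel
  have h3 (z : BalTensor k S X Y) : mapLeft Y q hq (mapLeft Y i hi z) = 0 := by
    induction z using induction_on with
    | zero => simp
    | mk x y => simp [hex.apply_apply_eq_zero, zero_mk]
    | add z z' h h' => simp [h, h']
  refine ⟨Function.LeftInverse.injective h1, fun z ↦ ⟨fun hz ↦ ⟨ρY z, ?_⟩, ?_⟩⟩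
  · have := h2 z
    rwa [hz, map_zero, add_zero] at this
  · rintro ⟨z, rfl⟩
    exact h3 z

/-- Bimodules which are isomorphic have isomorphic tensor products. -/
def congrLeft (e : X ≃ₗ[C] X') (he : ∀ (s : S) x, e (op s • x) = op s • e x) :
    BalTensor k S X Y ≃ₗ[C] BalTensor k S X' Y where
  __ := mapLeft Y e.toLinearMap he
  invFun := mapLeft (k := k) Y e.symm.toLinearMap fun s x ↦ e.injective (by simp [he])
  left_inv z := by
    induction z using induction_on with
    | zero => simp
    | mk x y => simp
    | add z z' h h' => simp_all
  right_inv z := by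
    induction z using induction_on with
    | zero => simp
    | mk x y => simp
    | add z z' h h' => simp_all

end BalTensor

/-! ### The left and right actions on a bimodule -/

section EnvActions

variable {k : Type w} [Field k] {R : Type u} [Ring R] [Algebra k R]

instance envLeft (N : ModuleCat.{u} (Env k R)) : Module R N :=
  Module.compHom N (Algebra.TensorProduct.includeLeft : R →ₐ[k] Env k R).toRingHom

instance envRight (N : ModuleCat.{u} (Env k R)) : Module Rᵐᵒᵖ N :=
  Module.compHom N (Algebra.TensorProduct.includeRight : Rᵐᵒᵖ →ₐ[k] Env k R).toRingHom

variable {N N' : ModuleCat.{u} (Env k R)}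

theorem env_left_smul (r : R) (x : N) : r • x = (r ⊗ₜ[k] (1 : Rᵐᵒᵖ) : Env k R) • x := rfl

theorem env_right_smul (r : Rᵐᵒᵖ) (x : N) : r • x = ((1 : R) ⊗ₜ[k] r : Env k R) • x := rfl

theorem env_tmul_smul (r : R) (t : Rᵐᵒᵖ) (x : N) :
    (r ⊗ₜ[k] t : Env k R) • x = r • t • x := by
  rw [env_left_smul, env_right_smul, smul_smul, Algebra.TensorProduct.tmul_mul_tmul, mul_one,
    one_mul]

instance : SMulCommClass R Rᵐᵒᵖ N where
  smul_comm r t x := by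
    rw [← env_tmul_smul, env_left_smul, env_right_smul, smul_smul,
      Algebra.TensorProduct.tmul_mul_tmul, mul_one, one_mul]

instance : SMulCommClass Rᵐᵒᵖ R N := .symm _ _ _

instance : IsScalarTower k R N where
  smul_assoc c r x := by
    rw [env_left_smul, env_left_smul, ← smul_assoc, TensorProduct.smul_tmul']

instance : IsScalarTower k Rᵐᵒᵖ N where
  smul_assoc c r x := by
    rw [env_right_smul, env_right_smul, ← smul_assoc, TensorProduct.tmul_smul]

/-- A homomorphism of bimodules as a homomorphism of left modules. -/
def leftHom (g : N ⟶ N') : N →ₗ[R] N' where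
  toFun := g.hom
  map_add' := map_add g.hom
  map_smul' r x := map_smul g.hom (r ⊗ₜ[k] 1 : Env k R) x

/-- A homomorphism of bimodules as a homomorphism of right modules. -/
def rightHom (g : N ⟶ N') : N →ₗ[Rᵐᵒᵖ] N' where
  toFun := g.hom
  map_add' := map_add g.hom
  map_smul' r x := map_smul g.hom (1 ⊗ₜ[k] r : Env k R) x

theorem leftHom_op_smul (g : N ⟶ N') (r : R) (x : N) :
    leftHom g (op r • x) = op r • leftHom g x := map_smul (rightHom g) (op r) x

section OfBimodule

variable (k R) (X : Type u) [AddCommGroup X] [Module k X] [Module R X] [Module Rᵐᵒᵖ X]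
  [IsScalarTower k R X] [IsScalarTower k Rᵐᵒᵖ X] [SMulCommClass R Rᵐᵒᵖ X]

/-- A module with commuting left and right actions as a module over the enveloping algebra. -/
def ofBimodule : ModuleCat.{u} (Env k R) :=
  letI : Module (Env k R) X := TensorProduct.Algebra.module
  ModuleCat.of (Env k R) X

/-- The identity map, as an additive equivalence. -/
def ofBimoduleEquiv : ofBimodule k R X ≃+ X := .refl X

variable {X}

theorem ofBimoduleEquiv_smul (r : R) (t : Rᵐᵒᵖ) (x : ofBimodule k R X) :
    ofBimoduleEquiv k R X ((r ⊗ₜ[k] t : Env k R) • x) = r • t • ofBimoduleEquiv k R X x :=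
  TensorProduct.Algebra.smul_def (M := X) r t x

variable (X)

/-- The identity map, as an equivalence of left modules. -/
def ofBimoduleLeft : ofBimodule k R X ≃ₗ[R] X where
  __ := ofBimoduleEquiv k R X
  map_smul' r x := (ofBimoduleEquiv_smul k R r 1 x).trans (by rw [one_smul]; rfl)

/-- The identity map, as an equivalence of right modules. -/
def ofBimoduleRight : ofBimodule k R X ≃ₗ[Rᵐᵒᵖ] X where
  __ := ofBimoduleEquiv k R X
  map_smul' r x := (ofBimoduleEquiv_smul k R 1 r x).trans (by rw [one_smul]; rfl)

end OfBimodule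

end EnvActions

/-! ### Restriction of right actions to a subalgebra -/

section Subalgebra

variable {k : Type w} [Field k] {A : Type u} [Ring A] [Algebra k A] {B : Subalgebra k A}
variable {X : Type*} [AddCommGroup X] [Module Aᵐᵒᵖ X]

instance opRestrict : Module (B : Type u)ᵐᵒᵖ X := Module.compHom X (AlgHom.op B.val).toRingHom

theorem op_restrict_smul (b : (B : Type u)ᵐᵒᵖ) (x : X) : b • x = op (unop b).1 • x := rfl

instance [Module k X] [IsScalarTower k Aᵐᵒᵖ X] : IsScalarTower k (B : Type u)ᵐᵒᵖ X where
  smul_assoc c b x := smul_assoc c (op (unop b).1) x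

instance {C : Type*} [SMul C X] [SMulCommClass C Aᵐᵒᵖ X] :
    SMulCommClass C (B : Type u)ᵐᵒᵖ X where
  smul_comm c b x := smul_comm c (op (unop b).1) x

instance {C : Type*} [SMul C X] [SMulCommClass Aᵐᵒᵖ C X] :
    SMulCommClass (B : Type u)ᵐᵒᵖ C X where
  smul_comm b c x := smul_comm (op (unop b).1) c x

end Subalgebra

end

end ProjBounded

namespace ProjBounded

noncomputable section

/-! ### Induced bimodules -/

section Induced

variable {k : Type w} [Field k] {A : Type u} [Ring A] [Algebra k A] (B : Subalgebra k A)

open BalTensor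

/-- The `A`-bimodule `A ⊗_B N ⊗_B A`. -/
def indEnv (N : ModuleCat.{u} (Env k A)) : ModuleCat.{u} (Env k A) :=
  ofBimodule k A (BalTensor k B A (BalTensor k B N A))

variable {B} (N : ModuleCat.{u} (Env k A)) in
/-- `A ⊗_B N ⊗_B A` as a left module. -/
def indEnvLeft : indEnv B N ≃ₗ[A] BalTensor k B A (BalTensor k B N A) := ofBimoduleLeft k A _

variable {B} (N : ModuleCat.{u} (Env k A)) in
/-- `A ⊗_B N ⊗_B A` as a right module. -/
def indEnvRight : indEnv B N ≃ₗ[Aᵐᵒᵖ] BalTensor k B A (BalTensor k B N A) := ofBimoduleRight k A _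

variable {B} {N E : ModuleCat.{u} (Env k A)}

/-- The element `a ⊗ n ⊗ a'` of `A ⊗_B N ⊗_B A`. -/
def indMk (a : A) (n : N) (a' : A) : indEnv B N :=
  (ofBimoduleEquiv k A _).symm (mk k B a (mk k B n a'))

theorem tmul_smul_indMk (b : A) (b' : A) (a : A) (n : N) (a' : A) :
    (b ⊗ₜ[k] op b' : Env k A) • (indMk a n a' : indEnv B N) = indMk (b * a) n (a' * b') :=
  (ofBimoduleEquiv k A _).injective ((ofBimoduleEquiv_smul k A b (op b') _).trans rfl)

theorem indMk_left (a : A) (b : B) (n : N) (a' : A) :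
    (indMk (a * b) n a' : indEnv B N) = indMk a (b • n) a' :=
  mk_balanced k B a b (mk k B n a')

theorem indMk_right (a : A) (b : B) (n : N) (a' : A) :
    (indMk a n (b * a') : indEnv B N) = indMk a (op b • n) a' :=
  (congrArg (mk k B a) (mk_balanced k B n b a')).symm

theorem indMk_add (a : A) (n n' : N) (a' : A) :
    (indMk a (n + n') a' : indEnv B N) = indMk a n a' + indMk a n' a' := by
  change mk k B a (mk k B (n + n') a') = mk k B a (mk k B n a') + mk k B a (mk k B n' a')
  rw [add_mk, mk_add]

@[elab_as_elim]
theorem indEnv_induction {p : indEnv B N → Prop} (x : indEnv B N) (zero : p 0)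
    (mk : ∀ a n a', p (indMk a n a')) (add : ∀ x y, p x → p y → p (x + y)) : p x := by
  change BalTensor k B A (BalTensor k B N A) at x
  induction x using BalTensor.induction_on with
  | zero => exact zero
  | mk a w =>
    induction w using BalTensor.induction_on with
    | zero =>
      rw [mk_zero]
      exact zero
    | mk n a' => exact mk a n a'
    | add w w' h h' =>
      rw [mk_add]
      exact add _ _ h h'
  | add x y h h' => exact add x y h h'

/-- Scalars of `k` lie in `B`, so an additive map that is left `B`-linear is `k`-linear and can be
fed to the tensor products over `k`. -/
theorem map_smul_of_left (θ : N →+ E) (hl : ∀ (b : B) n, θ (b • n) = b • θ n) (c : k) (n : N) :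
    θ (c • n) = c • θ n := by
  have h1 (F : ModuleCat.{u} (Env k A)) (x : F) : c • x = (algebraMap k B c) • x :=
    (algebraMap_smul A c x).symm
  rw [h1, h1, hl]

section Lift

variable (θ : N →+ E) (hl : ∀ (b : B) n, θ (b • n) = b • θ n)
  (hr : ∀ (b : B) n, θ (op b • n) = op b • θ n)

/-- The map `n ⊗ a ↦ θ(n) a`. -/
def indLiftRight : BalTensor k B N A →ₗ[B] E :=
  toLinear (lift (TensorProduct.lift (LinearMap.mk₂ k (fun (n : N) (a : A) ↦ op a • θ n)
    (fun _ _ _ ↦ by rw [map_add, smul_add])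
    (fun c n a ↦ by rw [map_smul_of_left θ hl, smul_comm])
    (fun _ _ _ ↦ by rw [MulOpposite.op_add, add_smul])
    (fun _ _ _ ↦ by rw [MulOpposite.op_smul, smul_assoc])))
    (fun n b a ↦ by
      change op a • θ (op b • n) = op ((b : A) * a) • θ n
      rw [hr, op_restrict_smul, smul_smul]; rfl))
    (fun b n a ↦ by
      change op a • θ (b • n) = b • op a • θ n
      rw [hl, smul_comm])

/-- The additive map underlying `indLift`. -/
def indLiftAdd : indEnv B N →+ E :=
  (lift (TensorProduct.lift (LinearMap.mk₂ k
      (fun (a : A) (w : BalTensor k B N A) ↦ a • indLiftRight θ hl hr w)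
      (fun _ _ _ ↦ by rw [add_smul])
      (fun _ _ _ ↦ by rw [smul_assoc])
      (fun _ _ _ ↦ by rw [map_add, smul_add])
      (fun c a w ↦ by
        rw [← algebraMap_smul B c w, map_smul, smul_comm c a, ← algebraMap_smul A c (_ : E)]; rfl)))
    (fun a b w ↦ by
      change (a * (b : A)) • indLiftRight θ hl hr w = a • indLiftRight θ hl hr (b • w)
      rw [map_smul, mul_smul]; rfl) : BalTensor k B A (BalTensor k B N A) →+ E).comp
    (ofBimoduleEquiv k A _).toAddMonoidHom

theorem indLiftAdd_indMk (a : A) (n : N) (a' : A) :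
    indLiftAdd θ hl hr (indMk a n a') = a • op a' • θ n := rfl

theorem indLiftAdd_smul (e : Env k A) (x : indEnv B N) :
    indLiftAdd θ hl hr (e • x) = e • indLiftAdd θ hl hr x := by
  induction e using TensorProduct.induction_on with
  | zero =>
    exact (congrArg (indLiftAdd θ hl hr) (zero_smul (Env k A) x)).trans
      ((map_zero _).trans (zero_smul (Env k A) (indLiftAdd θ hl hr x)).symm)
  | add e e' h h' => rw [add_smul, add_smul, map_add, h, h']
  | tmul b b' =>
    obtain ⟨b', rfl⟩ := op_surjective b'
    induction x using indEnv_induction with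
    | zero => simp
    | add x y h h' => rw [smul_add, map_add, map_add, smul_add, h, h']
    | mk a n a' =>
      rw [tmul_smul_indMk, env_tmul_smul, indLiftAdd_indMk, indLiftAdd_indMk,
        MulOpposite.op_mul, mul_smul, mul_smul, smul_comm a (op b')]

/-- The homomorphism `A ⊗_B N ⊗_B A → E` induced by a `B`-bimodule homomorphism `N → E`. -/
def indLift : indEnv B N ⟶ E :=
  ModuleCat.ofHom (X := (indEnv B N : Type u)) (Y := (E : Type u))
    { indLiftAdd θ hl hr with map_smul' := indLiftAdd_smul θ hl hr }

theorem indLift_indMk (a : A) (n : N) (a' : A) :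
    (indLift θ hl hr).hom (indMk a n a') = a • op a' • θ n := rfl

end Lift

variable (B N) in
/-- The multiplication map `A ⊗_B N ⊗_B A → N`. -/
def counit : indEnv B N ⟶ N := indLift (.id _) (fun _ _ ↦ rfl) (fun _ _ ↦ rfl)

theorem counit_indMk (a : A) (n : N) (a' : A) :
    (counit B N).hom (indMk a n a') = a • op a' • n := rfl

theorem counit_surjective : Function.Surjective (counit B N).hom :=
  fun n ↦ ⟨indMk 1 n 1, by rw [counit_indMk, MulOpposite.op_one, one_smul, one_smul]⟩

/-- Elements of `B` pass through both tensor signs, which makes `n ↦ 1 ⊗ n ⊗ 1` a map of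
`B`-bimodules. It is the relative splitting of `counit`. -/
theorem envInclusion_smul_indMk (e : Env k B) (n : N) :
    envInclusion B e • (indMk 1 n 1 : indEnv B N) = indMk 1 (envInclusion B e • n) 1 := by
  induction e using TensorProduct.induction_on with
  | zero =>
    have := indMk_add (B := B) (1 : A) (0 : N) 0 1
    rw [add_zero, left_eq_add] at this
    rw [map_zero]
    exact (zero_smul (Env k A) _).trans (this.symm.trans
      (congrArg (indMk 1 · 1) (zero_smul (Env k A) n).symm))
  | add e e' h h' => rw [map_add, add_smul, add_smul, indMk_add, h, h']
  | tmul b b' =>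
    obtain ⟨b', rfl⟩ := op_surjective b'
    have h1 : envInclusion B (b ⊗ₜ op b') = (b : A) ⊗ₜ[k] op (b' : A) := rfl
    rw [h1, tmul_smul_indMk, env_tmul_smul, one_mul, mul_one]
    have h2 : (indMk (1 * (b : A)) n ((b' : A) * 1) : indEnv B N) = indMk 1 (b • op b' • n) 1 := by
      rw [indMk_left, indMk_right, smul_comm b (op b')]
    rwa [one_mul, mul_one] at h2

variable (B N) in
/-- The map `n ↦ 1 ⊗ n ⊗ 1`. -/
def unit : (ModuleCat.restrictScalars (envInclusion B).toRingHom).obj N ⟶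
    (ModuleCat.restrictScalars (envInclusion B).toRingHom).obj (indEnv B N) :=
  ModuleCat.ofHom (X := (ModuleCat.restrictScalars (envInclusion B).toRingHom).obj N)
    (Y := (ModuleCat.restrictScalars (envInclusion B).toRingHom).obj (indEnv B N))
    { toFun := fun (n : N) ↦ (indMk (1 : A) n 1 : indEnv B N)
      map_add' := fun (n n' : N) ↦ indMk_add (B := B) (1 : A) n n' 1
      map_smul' := fun e (n : N) ↦ (envInclusion_smul_indMk e n).symm }

theorem counit_splits : IsSplitEpi
    ((ModuleCat.restrictScalars (envInclusion B).toRingHom).map (counit B N)) :=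
  ⟨⟨unit B N, by
    ext (n : N)
    change (counit B N).hom (indMk 1 n 1) = n
    rw [counit_indMk, MulOpposite.op_one, one_smul, one_smul]⟩⟩

/-- Induction is left adjoint to restriction: composing a `Bᵉ`-section with `unit` gives a `Bᵉ`-map
`N → E`, whose extension to `A ⊗_B N ⊗_B A` is an `Aᵉ`-section, as is checked on the generators `1 ⊗
n ⊗ 1`. -/
theorem isRelProjective_indEnv : IsRelProjective (envInclusion B).toRingHom (indEnv B N) := by
  rintro E g ⟨⟨τ, hτ⟩⟩
  let θ := unit B N ≫ τ
  have hθ (n : N) : g.hom (θ.hom n) = (indMk 1 n 1 : indEnv B N) := congr($hτ _)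
  let θ' : N →+ E := θ.hom.toAddMonoidHom
  have hl (b : B) (n : N) : θ' (b • n) = b • θ' n :=
    θ.hom.map_smul' (b ⊗ₜ[k] 1 : Env k B) n
  have hr (b : B) (n : N) : θ' (op b • n) = op b • θ' n :=
    θ.hom.map_smul' (1 ⊗ₜ[k] op b : Env k B) n
  refine ⟨⟨indLift θ' hl hr, ?_⟩⟩
  ext x
  change g.hom ((indLift θ' hl hr).hom x) = x
  induction x using indEnv_induction with
  | zero => simp
  | add x y h h' => rw [map_add, map_add, h, h']
  | mk a n a' =>
    have h1 : (indLift θ' hl hr).hom (indMk a n a') = (a ⊗ₜ[k] op a' : Env k A) • θ' n := by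
      rw [indLift_indMk, env_tmul_smul]
    rw [h1, map_smul]
    refine (congrArg _ (hθ n)).trans ?_
    rw [tmul_smul_indMk, mul_one, one_mul]

end Induced

end

end ProjBounded

namespace ProjBounded

noncomputable section

/-! ### Bounding dimensions over `A` by dimensions over `B` -/

section Ascent

variable {k : Type w} [Field k] {A : Type u} [Ring A] [Algebra k A] {B : Subalgebra k A}

open BalTensor

theorem projective_op_restrict (hA : Module.Projective (B : Type u)ᵐᵒᵖ A) {X : Type u}
    [AddCommGroup X] [Module k X] [Module Aᵐᵒᵖ X] [IsScalarTower k Aᵐᵒᵖ X]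
    (hX : Module.Projective Aᵐᵒᵖ X) : Module.Projective (B : Type u)ᵐᵒᵖ X := by
  rw [← pdLE_zero_iff] at hX ⊢
  have h : PdLE (B : Type u)ᵐᵒᵖ Aᵐᵒᵖ 0 := by
    rw [pdLE_zero_iff]
    exact .of_equiv ({ opAddEquiv with map_smul' := fun _ _ ↦ rfl } :
      A ≃ₗ[(B : Type u)ᵐᵒᵖ] Aᵐᵒᵖ)
  have : IsScalarTower (B : Type u)ᵐᵒᵖ Aᵐᵒᵖ X := ⟨fun b a x ↦ mul_smul (op (unop b).1) a x⟩
  exact h.restrict (k := k) hX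

variable (B) in
/-- A bimodule which is projective as a right `A`-module and has finite projective dimension as a
left `B`-module. -/
structure IsTame (Z : Type u) [AddCommGroup Z] [Module B Z] [Module Aᵐᵒᵖ Z] : Prop where
  projective : Module.Projective Aᵐᵒᵖ Z
  finite : ∃ d, PdLE B Z d

theorem IsTame.balTensor (hA : Module.Projective (B : Type u)ᵐᵒᵖ A) (hA' : ∃ d, PdLE B A d)
    {N : ModuleCat.{u} (Env k A)} (hN : IsTame B N) : IsTame B (BalTensor k B N A) where
  projective := by
    have := projective_op_restrict (k := k) hA hN.projective
    exact projective_right k B N A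
  finite := by
    have := projective_op_restrict (k := k) hA hN.projective
    obtain ⟨d, hd⟩ := hN.finite
    obtain ⟨e, he⟩ := hA'
    exact ⟨d + e, hd.balTensor he⟩

theorem IsTame.indEnv (hA : Module.Projective (B : Type u)ᵐᵒᵖ A) (hA' : ∃ d, PdLE B A d)
    {N : ModuleCat.{u} (Env k A)} (hN : IsTame B N) : IsTame B (indEnv B N) where
  projective := by
    have := (hN.balTensor hA hA').projective
    have : Module.Projective Aᵐᵒᵖ (BalTensor k B A (BalTensor k B N A)) :=
      projective_right k B A (BalTensor k B N A)
    exact .of_equiv (indEnvRight N).symm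
  finite := by
    obtain ⟨d, hd⟩ := hA'
    obtain ⟨e, he⟩ := (hN.balTensor hA ⟨d, hd⟩).finite
    have h : PdLE B (BalTensor k B A (BalTensor k B N A)) (d + e) := hd.balTensor he
    exact ⟨d + e, h.of_equiv ((indEnvLeft N).restrictScalars B)⟩

/-- By associativity the module is `A ⊗_B ((N ⊗_B A) ⊗_A M)`, and induction along `B ⊆ A` does not
raise projective dimension when `A` is right `B`-projective. -/
theorem pdLE_indEnv_balTensor (hA : Module.Projective (B : Type u)ᵐᵒᵖ A)
    {N : ModuleCat.{u} (Env k A)} {M : Type u} [AddCommGroup M] [Module k M] [Module A M]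
    [IsScalarTower k A M] {b : ℕ} (h : PdLE B (BalTensor k A (BalTensor k B N A) M) b) :
    PdLE A (BalTensor k A (indEnv B N) M) b := by
  have h0 : PdLE A A 0 := (pdLE_zero_iff A A).2 inferInstance
  have h1 : PdLE A (BalTensor k B A (BalTensor k A (BalTensor k B N A) M)) (0 + b) :=
    h0.balTensor h
  rw [zero_add] at h1
  exact h1.of_equiv ((congrLeft M (indEnvLeft N)
    fun s x ↦ map_smul (indEnvRight N) (op s) x).trans
      (assoc k B A A (BalTensor k B N A) M A))

/-- Induction along the canonical resolution of `N`. The bimodule `Z` carries the given finite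
resolution and merely counts the steps left; only the tame `N` is ever tensored with `M`. -/
theorem pdLE_balTensor_of_relDimLT (hA : Module.Projective (B : Type u)ᵐᵒᵖ A)
    (hA' : ∃ d, PdLE B A d) {M : Type u} [AddCommGroup M] [Module k M] [Module A M]
    [IsScalarTower k A M] {b : ℕ}
    (hM : ∀ N : ModuleCat.{u} (Env k A), IsTame B N →
      PdLE B (BalTensor k A (BalTensor k B N A) M) b) (n : ℕ) :
    ∀ N Z : ModuleCat.{u} (Env k A), IsTame B N →
      StableRetract (envInclusion B).toRingHom N Z →
      RelDimLT (envInclusion B).toRingHom n Z → PdLE A (BalTensor k A N M) (b + n) := by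
  induction n with
  | zero =>
    intro N Z hN hNZ hZ
    -- With `Z = 0`, `N` is a retract of `A ⊗_B N ⊗_B A`, so the bound `b` for the latter passes to
    -- `N ⊗_A M`.
    obtain ⟨s, hs⟩ := hNZ.exists_section hZ (counit B N) counit_splits
    refine (pdLE_indEnv_balTensor hA (hM N hN)).of_retract
      (mapLeft M (leftHom s) (leftHom_op_smul s))
      (mapLeft M (leftHom (counit B N)) (leftHom_op_smul _)) fun z ↦ ?_
    induction z using BalTensor.induction_on with
    | zero => simp
    | mk x y => exact congrArg (mk k A · y) congr($hs x)
    | add z z' h h' => rw [map_add, map_add, h, h']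
  | succ n ih =>
    intro N Z hN hNZ hZ
    obtain ⟨Z', P, j, p, w, hS, hp, hP, hZ'⟩ := hZ
    have hT := hN.indEnv hA hA'
    let ε := counit B N
    have hε : Function.Surjective ε.hom := counit_surjective
    obtain ⟨K, ι, wι, hSι, hι, hex⟩ := exists_kernel ε hε
    have hproj := hN.projective
    -- On the right, the kernel of a surjection between projectives is projective; on the left,
    -- finite dimension passes to the kernel.
    have hK : IsTame B K := by
      constructor
      · have h2 := hT.projective
        have h3 := hN.projective
        rw [← pdLE_zero_iff] at h2 h3 ⊢
        exact h2.first (h3.mono zero_le_one) (f := rightHom ι) (g := rightHom ε) hι hex hε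
      · obtain ⟨d, hd⟩ := hT.finite
        obtain ⟨e, he⟩ := hN.finite
        exact ⟨d + e, (hd.mono (by omega)).first (he.mono (by omega))
          (f := (leftHom ι).restrictScalars B) (g := (leftHom ε).restrictScalars B) hι hex hε⟩
    have h1 := ih K Z' hK (hNZ.syzygy isRelProjective_indEnv hP hSι
      counit_splits hS hp) hZ'
    -- Right projectivity of `N` keeps the sequence exact after `- ⊗_A M`.
    obtain ⟨hinj, hexact⟩ := mapLeft_injective_exact (k := k) (S := A) M (leftHom ι) (leftHom_op_smul ι)
      (leftHom ε) (leftHom_op_smul ε) hι hex hε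
    exact h1.third ((pdLE_indEnv_balTensor hA (hM N hN)).mono (by omega)) hinj hexact
      (mapLeft_surjective _ _ hε)

/-- The bimodule `A` as a left module. -/
def regularLeft : regular k A ≃ₗ[A] A where
  __ := AddEquiv.refl A
  map_smul' a (x : A) := by
    change AlgHom.mulLeftRight k A (a ⊗ₜ 1) x = a * x
    simp

/-- The bimodule `A` as a right module. -/
def regularRight : regular k A ≃ₗ[Aᵐᵒᵖ] A where
  __ := AddEquiv.refl A
  map_smul' a (x : A) := by
    change AlgHom.mulLeftRight k A (1 ⊗ₜ a) x = x * unop a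
    simp

variable (k) in
/-- The tensor product with the regular bimodule. -/
def regularTensor (M : Type u) [AddCommGroup M] [Module k M] [Module A M]
    [IsScalarTower k A M] : BalTensor k A (regular k A) M ≃ₗ[A] M :=
  (congrLeft M regularLeft fun s x ↦ map_smul regularRight (op s) x).trans (unitEquiv k A A M)

theorem isTame_regular (hA' : ∃ d, PdLE B A d) : IsTame B (regular k A) where
  projective := .of_equiv (regularRight (k := k) (A := A)).symm
  finite := hA'.imp fun _ h ↦ h.of_equiv (regularLeft.restrictScalars B)

/-- If `A` has finite relative projective dimension as a bimodule, then projective dimensions over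
`A` are bounded by projective dimensions over `B`. -/
theorem exists_pdLE_of_hasFiniteRelProjDim (hA : Module.Projective (B : Type u)ᵐᵒᵖ A)
    (hA' : ∃ d, PdLE B A d) (h : HasFiniteRelProjDim (envInclusion B).toRingHom (regular k A)) :
    ∃ n, ∀ (M : Type u) [AddCommGroup M] [Module k M] [Module A M] [IsScalarTower k A M] (b : ℕ),
      (∀ N : ModuleCat.{u} (Env k A), IsTame B N →
        PdLE B (BalTensor k A (BalTensor k B N A) M) b) → PdLE A M (b + n) := by
  obtain ⟨n, ⟨r⟩⟩ := h
  refine ⟨n + 2, fun M _ _ _ _ b hM ↦ ?_⟩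
  exact (pdLE_balTensor_of_relDimLT hA hA' hM (n + 2) _ _ (isTame_regular hA')
    (.refl (isRelProjective_indEnv (N := regular k A))) r.relDimLT).of_equiv
    (regularTensor k M).symm

end Ascent

end

end ProjBounded

namespace ProjBounded

noncomputable section

/-! ### Projective bimodules -/

section ProjectiveBimodule

variable {k : Type w} [Field k] {R : Type u} [Ring R] [Algebra k R]
variable (X : ModuleCat.{u} (Env k R)) (Y : Type u) [AddCommGroup Y] [Module k Y] [Module R Y]
  [IsScalarTower k R Y]

open BalTensor

/-- The map `(a ⊗ t ⊗ x) ⊗ y ↦ a ⊗ (x ⊗ t y)`. -/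
def envTransfer : ((Env k R) ⊗[k] X) ⊗[k] Y →ₗ[k] R ⊗[k] (X ⊗[k] Y) :=
  TensorProduct.lift (TensorProduct.lift (TensorProduct.lift (LinearMap.mk₂ k
    (fun (a : R) (t : Rᵐᵒᵖ) ↦ ((TensorProduct.mk k X Y).compr₂
      (TensorProduct.mk k R (X ⊗[k] Y) a)).compl₂ (Algebra.lsmul k k Y (unop t)))
    (fun _ _ _ ↦ by ext; simp)
    (fun _ _ _ ↦ by ext; simp [TensorProduct.smul_tmul'])
    (fun _ _ _ ↦ by ext; simp [TensorProduct.tmul_add])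
    (fun _ _ _ ↦ by ext; simp))))

variable {X Y}

@[simp]
theorem envTransfer_tmul (a : R) (t : Rᵐᵒᵖ) (x : X) (y : Y) :
    envTransfer X Y (((a ⊗ₜ[k] t : Env k R) ⊗ₜ x) ⊗ₜ y) = a ⊗ₜ (x ⊗ₜ (unop t • y)) := by
  simp [envTransfer]

@[elab_as_elim]
theorem env_tensor_induction {V : Type*} [AddCommGroup V] [Module k V]
    {p : (Env k R) ⊗[k] V → Prop} (x : (Env k R) ⊗[k] V) (zero : p 0)
    (tmul : ∀ a t v, p ((a ⊗ₜ[k] t : Env k R) ⊗ₜ v)) (add : ∀ x y, p x → p y → p (x + y)) :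
    p x := by
  induction x using TensorProduct.induction_on with
  | zero => exact zero
  | add x y h h' => exact add x y h h'
  | tmul e v =>
    induction e using TensorProduct.induction_on with
    | zero =>
      have : (0 : Env k R) ⊗ₜ[k] v = 0 := TensorProduct.zero_tmul _ _
      exact this ▸ zero
    | tmul a t => exact tmul a t v
    | add e e' h h' =>
      rw [TensorProduct.add_tmul]
      exact add _ _ h h'

theorem envTransfer_smul (a : R) (t : Rᵐᵒᵖ) (w : (Env k R) ⊗[k] X) (y : Y) :
    envTransfer X Y (((a ⊗ₜ[k] t : Env k R) • w) ⊗ₜ y) =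
      a • envTransfer X Y (w ⊗ₜ (unop t • y)) := by
  induction w using env_tensor_induction with
  | zero => simp
  | tmul b t' x => simp [TensorProduct.smul_tmul', mul_smul]
  | add w w' h h' => simp only [smul_add, TensorProduct.add_tmul, map_add, h, h']

/-- As `X` is a retract of `Rᵉ ⊗_k X`, the module `X ⊗_R Y` is a retract of `R ⊗_k (X ⊗_k Y)`, which
is free. No condition on `Y` is needed: its `R`-action is absorbed by the right factor of `Rᵉ`. -/
theorem pdLE_balTensor_of_projective (hX : Module.Projective (Env k R) X) :
    PdLE R (BalTensor k R X Y) 0 := by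
  obtain ⟨s, hs⟩ := freeCover_splits k (Env k R) X
  have hs1 (a : R) (x : X) : s (a • x) = (a ⊗ₜ[k] 1 : Env k R) • s x := map_smul s _ _
  have hs2 (a : R) (x : X) : s (op a • x) = (1 ⊗ₜ[k] op a : Env k R) • s x := map_smul s _ _
  let i : BalTensor k R X Y →ₗ[R] R ⊗[k] (X ⊗[k] Y) :=
    toLinear (lift ((envTransfer X Y).comp ((s.restrictScalars k).rTensor Y))
      (fun x r y ↦ by
        change envTransfer X Y (s (op r • x) ⊗ₜ y) = envTransfer X Y (s x ⊗ₜ (r • y))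
        rw [hs2, envTransfer_smul, one_smul, unop_op]))
      (fun r x y ↦ by
        change envTransfer X Y (s (r • x) ⊗ₜ y) = r • envTransfer X Y (s x ⊗ₜ y)
        rw [hs1, envTransfer_smul, unop_one, one_smul])
  let π : X ⊗[k] Y →ₗ[k] BalTensor k R X Y :=
    { proj k R X Y with
      map_smul' := fun c t ↦ by
        change proj k R X Y (c • t) = c • proj k R X Y t
        induction t using TensorProduct.induction_on with
        | zero => simp
        | tmul x y => rfl
        | add t t' h h' => simp only [smul_add, map_add, h, h'] }
  let r : R ⊗[k] (X ⊗[k] Y) →ₗ[R] BalTensor k R X Y :=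
    freeCover k R _ ∘ₗ TensorProduct.AlgebraTensorModule.map .id π
  have hr (w : (Env k R) ⊗[k] X) (y : Y) : r (envTransfer X Y (w ⊗ₜ y)) =
      mk k R (freeCover k (Env k R) X w) y := by
    induction w using env_tensor_induction with
    | zero => simp [zero_mk]
    | tmul a t x =>
      rw [envTransfer_tmul, freeCover_tmul, env_tmul_smul, ← smul_mk, ← op_unop t, mk_balanced]
      simp [r, π, proj_tmul]
    | add w w' h h' => simp only [TensorProduct.add_tmul, map_add, add_mk, h, h']
  refine ((pdLE_zero_iff R (R ⊗[k] (X ⊗[k] Y))).2 inferInstance).of_retract i r fun z ↦ ?_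
  induction z using BalTensor.induction_on with
  | zero => simp
  | mk x y => exact (hr (s x) y).trans (congrArg (mk k R · y) (hs x))
  | add z z' h h' => rw [map_add, map_add, h, h']

theorem left_smul_env (r : R) (e : Env k R) : r • e = (r ⊗ₜ[k] 1 : Env k R) * e := by
  induction e using TensorProduct.induction_on with
  | zero => simp
  | tmul a t => simp [TensorProduct.smul_tmul']
  | add y y' h h' => rw [smul_add, mul_add, h, h']

/-- Restriction of scalars along `R → Rᵉ` costs nothing, since `R ⊗_k Rᵐᵒᵖ` is free as a left
`R`-module. -/
theorem PdLE.of_env {d : ℕ} (h : PdLE (Env k R) X d) : PdLE R X d := by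
  have h0 : PdLE R (Env k R) 0 := by
    rw [pdLE_zero_iff]
    exact Module.Projective.tensorProduct
  have : SMulCommClass R (Env k R)ᵐᵒᵖ (Env k R) := ⟨fun r e x ↦ by
    rw [left_smul_env, left_smul_env, smul_eq_mul_unop, smul_eq_mul_unop, mul_assoc]⟩
  have : IsScalarTower R (Env k R) X := ⟨fun r e x ↦ by
    rw [left_smul_env, mul_smul, env_left_smul]⟩
  simpa using h0.restrict (k := k) h

/-! ### Tensor products of bimodules -/

variable (M N : ModuleCat.{u} (Env k R))

variable {M N} in
theorem proj_outerAct (e : Env k R) (t : M ⊗[k] N) : proj k R M N (outerAct k M N e t) =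
    ofBimoduleEquiv k R _ (e • (ofBimoduleEquiv k R _).symm (proj k R M N t)) := by
  induction e using TensorProduct.induction_on with
  | zero =>
    exact (map_zero (proj k R M N)).trans
      ((congrArg (ofBimoduleEquiv k R (BalTensor k R M N)) (zero_smul (Env k R) _)).trans
        (map_zero _)).symm
  | add e e' h h' => rw [map_add, LinearMap.add_apply, map_add, h, h', add_smul, map_add]
  | tmul a b =>
    rw [ofBimoduleEquiv_smul, AddEquiv.apply_symm_apply]
    induction t using TensorProduct.induction_on with
    | zero => simp
    | tmul m n => rfl
    | add t t' h h' => rw [map_add, map_add, h, h', map_add, smul_add, smul_add]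

/-- The canonical map from `M ⊗_k N` to the balanced tensor product, as a map of bimodules. -/
def outerProj : OuterTensor k M N →ₗ[Env k R] ofBimodule k R (BalTensor k R M N) where
  toFun := proj k R M N
  map_add' := map_add (proj k R M N)
  map_smul' e t := proj_outerAct e (t : M ⊗[k] N)

theorem smul_mem_balancingRel (c : k) (t : M ⊗[k] N)
    (h : @Membership.mem (OuterTensor k M N) _ _ (balancingRel k M N) t) :
    @Membership.mem (OuterTensor k M N) _ _ (balancingRel k M N) (c • t) := by
  have h1 := (balancingRel k M N).smul_mem (algebraMap k (Env k R) c) h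
  have h2 : outerAct k M N (algebraMap k (Env k R) c) t = c • t := by
    rw [AlgHom.commutes]
    rfl
  rw [← h2]
  exact h1

/-- One side is a span over `k`, the other over `Rᵉ`, of the same relations. They agree because the
kernel is stable under `Rᵉ`, while `k` acts through `Rᵉ`. -/
theorem ker_outerProj : LinearMap.ker (outerProj M N) = balancingRel k M N := by
  refine le_antisymm (fun t ht ↦ ?_) (Submodule.span_le.2 ?_)
  · have ht' : t ∈ balRel k R M N := (Submodule.Quotient.mk_eq_zero (balRel k R M N)).1 ht
    induction ht' using Submodule.span_induction with
    | mem t h =>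
      obtain ⟨x, s, y, rfl⟩ := h
      exact Submodule.subset_span ⟨x, s, y, rfl⟩
    | zero => exact zero_mem _
    | add t t' h1 h2 h h' =>
      exact add_mem (h ((Submodule.Quotient.mk_eq_zero (balRel k R M N)).2 h1))
        (h' ((Submodule.Quotient.mk_eq_zero (balRel k R M N)).2 h2))
    | smul c t h1 h =>
      exact smul_mem_balancingRel M N c t
        (h ((Submodule.Quotient.mk_eq_zero (balRel k R M N)).2 h1))
  · rintro _ ⟨x, s, y, rfl⟩
    exact (map_sub (proj k R M N) _ _).trans (sub_eq_zero.2 (mk_balanced k R x s y))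

/-- The two descriptions of the tensor product of bimodules agree. -/
def bimodTensorEquiv : bimodTensor k M N ≃ₗ[Env k R] ofBimodule k R (BalTensor k R M N) :=
  (Submodule.quotEquivOfEq _ _ (ker_outerProj M N).symm).trans
    ((outerProj M N).quotKerEquivOfSurjective (proj_surjective k R M N))

/-- The two descriptions of the tensor product of bimodules agree as left modules. -/
def bimodTensorLeft : bimodTensor k M N ≃ₗ[R] BalTensor k R M N :=
  LinearEquiv.trans
    ({ bimodTensorEquiv M N with
      map_smul' := fun r x ↦ map_smul (bimodTensorEquiv M N) (r ⊗ₜ[k] 1 : Env k R) x } :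
      bimodTensor k M N ≃ₗ[R] ofBimodule k R (BalTensor k R M N))
    (ofBimoduleLeft k R (BalTensor k R M N))

theorem bimodTensorLeft_op_smul (r : R) (x : bimodTensor k M N) :
    bimodTensorLeft M N (op r • x) = op r • bimodTensorLeft M N x :=
  (congrArg (ofBimoduleEquiv k R (BalTensor k R M N))
    (map_smul (bimodTensorEquiv M N) (1 ⊗ₜ[k] op r : Env k R) x)).trans
    (map_smul (ofBimoduleRight k R (BalTensor k R M N)) (op r) (bimodTensorEquiv M N x))

variable (Y) in
/-- `(M ⊗_R N) ⊗_R Y ≅ M ⊗_R (N ⊗_R Y)`. -/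
def bimodTensorAssoc : BalTensor k R (bimodTensor k M N) Y ≃ₗ[R]
    BalTensor k R M (BalTensor k R N Y) :=
  (congrLeft Y (bimodTensorLeft M N) (bimodTensorLeft_op_smul M N)).trans
    (assoc k R R M N Y R)

end ProjectiveBimodule

end

end ProjBounded

namespace ProjBounded

noncomputable section

/-! ### Bounding dimensions over `B` by dimensions over `A` -/

section Descent

variable {k : Type w} [Field k] {A : Type u} [Ring A] [Algebra k A] {B : Subalgebra k A}

open BalTensor

variable (B) in
/-- The projection of bimodules `A → A/B`. -/
def toQuot : ambient B ⟶ quot B :=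
  ModuleCat.ofHom (X := (ambient B : Type u)) (Y := (quot B : Type u))
    (LinearMap.range (bimodInclusion B).hom).mkQ

theorem bimodInclusion_injective : Function.Injective (bimodInclusion B).hom :=
  fun _ _ h ↦ Subtype.ext h

theorem bimodInclusion_exact : Function.Exact (bimodInclusion B).hom (toQuot B).hom :=
  LinearMap.exact_map_mkQ_range _

theorem toQuot_surjective : Function.Surjective (toQuot B).hom :=
  Submodule.mkQ_surjective _

variable (B) in
/-- The bimodule `A` as a left `B`-module. -/
def ambientLeft : ambient B ≃ₗ[B] A where
  __ := AddEquiv.refl A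
  map_smul' a (x : A) := by
    change AlgHom.mulLeftRight k A (envInclusion B (a ⊗ₜ 1)) x = a * x
    simp [envInclusion]

variable (B) in
/-- The bimodule `A` as a right `B`-module. -/
def ambientRight : ambient B ≃ₗ[(B : Type u)ᵐᵒᵖ] A where
  __ := AddEquiv.refl A
  map_smul' a (x : A) := by
    change AlgHom.mulLeftRight k A (envInclusion B (1 ⊗ₜ a)) x = x * (unop a).1
    simp [envInclusion]

theorem projective_right_of_quot (h : Module.Projective (B : Type u)ᵐᵒᵖ (quot B)) :
    Module.Projective (B : Type u)ᵐᵒᵖ A := by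
  have hB : PdLE (B : Type u)ᵐᵒᵖ (regular k B) 0 :=
    (pdLE_zero_iff _ _).2 (.of_equiv (regularRight (k := k) (A := B)).symm)
  rw [← pdLE_zero_iff] at h ⊢
  exact (hB.second h (f := rightHom (bimodInclusion B)) (g := rightHom (toQuot B))
    bimodInclusion_injective bimodInclusion_exact toQuot_surjective).of_equiv (ambientRight B).symm

theorem exists_pdLE_of_quot (h : ∃ d, PdLE B (quot B) d) : ∃ d, PdLE B A d := by
  obtain ⟨d, h⟩ := h
  have hB : PdLE B (regular k B) 0 :=
    (pdLE_zero_iff _ _).2 (.of_equiv (regularLeft (k := k) (A := B)).symm)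
  exact ⟨d, ((hB.mono d.zero_le).second h (f := leftHom (bimodInclusion B))
    (g := leftHom (toQuot B)) bimodInclusion_injective bimodInclusion_exact
    toQuot_surjective).of_equiv (ambientLeft B).symm⟩

variable (Y : Type u) [AddCommGroup Y] [Module k Y] [Module B Y] [IsScalarTower k B Y]

variable {Y} in
-- Right projectivity of `A/B` keeps `Y → A ⊗_B Y → A/B ⊗_B Y` short exact. As `Y` is the kernel
-- term, the constant `c` does not grow, so the lemma can be iterated.
theorem pdLE_of_induced_of_quot (hQ : Module.Projective (B : Type u)ᵐᵒᵖ (quot B)) {c : ℕ}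
    (hA : PdLE B (BalTensor k B A Y) c) (h : PdLE B (BalTensor k B (quot B) Y) c) :
    PdLE B Y c := by
  obtain ⟨hinj, hex⟩ := mapLeft_injective_exact (k := k) (S := B) Y (leftHom (bimodInclusion B))
    (leftHom_op_smul _) (leftHom (toQuot B)) (leftHom_op_smul _) bimodInclusion_injective
    bimodInclusion_exact toQuot_surjective
  have h1 : PdLE B (BalTensor k B (ambient B) Y) c :=
    hA.of_equiv (congrLeft Y (ambientLeft B) fun s x ↦ map_smul (ambientRight B) (op s) x)
  exact (h1.first (h.mono c.le_succ) hinj hex (mapLeft_surjective _ _ toQuot_surjective)).of_equiv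
    (regularTensor k Y).symm

/-- If a tensor power of `A/B` is a projective bimodule, then projective dimensions over `B` are
bounded by projective dimensions over `A`. -/
theorem pdLE_of_bimodPow_projective (hQ : Module.Projective (B : Type u)ᵐᵒᵖ (quot B)) {d e : ℕ}
    (hBA : PdLE B A d) {p : ℕ} (hp : Module.Projective (Env k B) (bimodPow k (quot B) p))
    (hY : ∀ n, PdLE A (BalTensor k B A (BalTensor k B (bimodPow k (quot B) n) Y)) e) :
    PdLE B Y (d + e) := by
  have step (n : ℕ) : PdLE B (BalTensor k B (bimodPow k (quot B) n) Y) (d + e) →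
      PdLE B Y (d + e) := by
    induction n with
    | zero => exact fun h ↦ h.of_equiv (regularTensor k Y).symm
    | succ n ih =>
      intro h
      -- Applied to `(A/B)^{⊗n} ⊗_B Y` in place of `Y`. The module induced to `A` has dimension at
      -- most `e` over `A`, hence at most `d + e` over `B`.
      exact ih (pdLE_of_induced_of_quot hQ (hBA.restrict (k := k) (hY n))
        (h.of_equiv (bimodTensorAssoc Y _ _).symm))
  exact step p ((pdLE_balTensor_of_projective hp).mono (Nat.zero_le _))

/-- The bound grows with `n`, but only finiteness matters: it makes `Findim A` applicable to the
modules induced from these tensor products. -/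
theorem exists_pdLE_bimodPow (hQ : Module.Projective (B : Type u)ᵐᵒᵖ (quot B))
    (hQ' : ∃ d, PdLE B (quot B) d) (hY : ∃ e, PdLE B Y e) (n : ℕ) :
    ∃ e, PdLE B (BalTensor k B (bimodPow k (quot B) n) Y) e := by
  induction n with
  | zero => exact hY.imp fun _ h ↦ h.of_equiv (regularTensor k Y)
  | succ n ih =>
    obtain ⟨d, hd⟩ := hQ'
    obtain ⟨e, he⟩ := ih
    exact ⟨d + e, (hd.balTensor he).of_equiv (bimodTensorAssoc Y _ _)⟩

end Descent

/-! ### Finiteness of the homological dimensions -/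

section Finiteness

theorem iSup_ne_top_iff {ι : Sort*} (f : ι → WithBot ℕ∞) :
    ⨆ i, f i ≠ ⊤ ↔ ∃ n : ℕ, ∀ i, f i ≤ n := by
  constructor
  · intro h
    have hle (i) : f i ≤ ⨆ i, f i := le_iSup f i
    generalize ⨆ i, f i = s at h hle
    induction s with
    | bot => exact ⟨0, fun i ↦ (hle i).trans bot_le⟩
    | coe s =>
      induction s with
      | top => exact absurd rfl h
      | coe n => exact ⟨n, hle⟩
  · rintro ⟨n, hn⟩ h
    have := iSup_le hn
    rw [h, top_le_iff] at this
    exact ENat.natCast_ne_top n (WithBot.coe_eq_coe.1 this)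

variable {R : Type u} [Ring R]

theorem leftGlobalDim_ne_top_iff : leftGlobalDim R ≠ ⊤ ↔
    ∃ n, ∀ (M : Type u) [AddCommGroup M] [Module R M], PdLE R M n := by
  rw [leftGlobalDim, iSup_ne_top_iff]
  simp only [projectiveDimension_le_iff]
  exact exists_congr fun n ↦ ⟨fun h M _ _ ↦ h (ModuleCat.of R M), fun h M ↦ h M⟩

theorem leftFindim_ne_top_iff : leftFindim R ≠ ⊤ ↔
    ∃ n, ∀ (M : Type u) [AddCommGroup M] [Module R M], (∃ d, PdLE R M d) → PdLE R M n := by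
  rw [leftFindim, iSup_ne_top_iff]
  simp only [projectiveDimension_le_iff, Subtype.forall, projectiveDimension_ne_top_iff]
  exact exists_congr fun n ↦ ⟨fun h M _ _ ↦ h (ModuleCat.of R M), fun h M ↦ h M⟩

end Finiteness

end

end ProjBounded

/-! ### Assembly of the two bounds -/

open ProjBounded

theorem mainTheorem1 {k : Type w} {A : Type u} [Field k] [Ring A] [Algebra k A]
    (B : Subalgebra k A)
    (hBA : ProjBounded.IsStronglyProjBounded B)
    (hright : Projective (ProjBounded.toRight k (ProjBounded.quot B))) :
    (ProjBounded.leftGlobalDim B ≠ ⊤ ↔ ProjBounded.leftGlobalDim A ≠ ⊤) ∧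
    (ProjBounded.leftFindim B ≠ ⊤ ↔ ProjBounded.leftFindim A ≠ ⊤) := by
  have hQ : Module.Projective (B : Type u)ᵐᵒᵖ (quot B) :=
    (IsProjective.iff_projective (R := (B : Type u)ᵐᵒᵖ) (toRight k (quot B))).2 hright
  have hQ' : ∃ d, PdLE B (quot B) d := by
    obtain ⟨d, hd⟩ := (projectiveDimension_ne_top_iff _).1 hBA.finite_projDim
    exact ⟨d, PdLE.of_env hd⟩
  have hA := projective_right_of_quot hQ
  have hA' := exists_pdLE_of_quot hQ'
  obtain ⟨n, hn⟩ := exists_pdLE_of_hasFiniteRelProjDim hA hA' hBA.finite_relProjDim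
  obtain ⟨p, -, hp⟩ := hBA.tensor_powers
  have hp' : Module.Projective (Env k B) (bimodPow k (quot B) p) :=
    (IsProjective.iff_projective (R := Env k B) _).2 (hp p le_rfl)
  have h0 : PdLE A A 0 := (pdLE_zero_iff A A).2 inferInstance
  obtain ⟨d, hd⟩ := hA'
  rw [leftGlobalDim_ne_top_iff, leftGlobalDim_ne_top_iff, leftFindim_ne_top_iff,
    leftFindim_ne_top_iff]
  refine ⟨⟨?_, ?_⟩, ?_, ?_⟩
  · rintro ⟨b, hb⟩
    exact ⟨b + n, fun M _ _ ↦
      -- The dimensions range over bare `A`-modules; the `k`-structure needed for the tensor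
      -- products is recovered from the `A`-action.
      let := Module.restrictScalars k A M
      have := IsScalarTower.restrictScalars k A M
      hn M b fun N _ ↦ hb _⟩
  · rintro ⟨e, he⟩
    exact ⟨d + e, fun Y _ _ ↦
      let := Module.restrictScalars k B Y
      have := IsScalarTower.restrictScalars k B Y
      pdLE_of_bimodPow_projective Y hQ hd hp' fun n ↦ he _⟩
  · rintro ⟨b, hb⟩
    refine ⟨b + n, fun M _ _ ⟨m, hm⟩ ↦ ?_⟩
    let := Module.restrictScalars k A M
    have := IsScalarTower.restrictScalars k A M
    refine hn M b fun N hN ↦ hb _ ?_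
    -- Tameness of `N ⊗_B A` makes `(N ⊗_B A) ⊗_A M` of finite dimension over `B`, so `Findim B`
    -- bounds it by `b`, independently of `z` and `m`.
    obtain ⟨z, hz⟩ := (hN.balTensor hA ⟨d, hd⟩).finite
    have := (hN.balTensor hA ⟨d, hd⟩).projective
    exact ⟨z + m, hz.balTensor hm⟩
  · rintro ⟨e, he⟩
    refine ⟨d + e, fun Y _ _ hY ↦ ?_⟩
    let := Module.restrictScalars k B Y
    have := IsScalarTower.restrictScalars k B Y
    refine pdLE_of_bimodPow_projective Y hQ hd hp' fun n ↦ he _ ?_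
    obtain ⟨z, hz⟩ := exists_pdLE_bimodPow (k := k) Y hQ hQ' hY n
    exact ⟨0 + z, h0.balTensor hz⟩
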